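/- Let $G$ be a compact semisimple Lie group (realized, as always possible, as a compact group of units of a finite-dimensional real associative algebra, so that $\mathrm{Ad}(g)X=gXg^{-1}$ and brackets are commutators) whose Lie algebra is a Hermitian symmetric Lie algebra $\mathfrak g=\mathfrak m\oplus\mathfrak h$, $\mathfrak m\neq0$: $[\mathfrak h,\mathfrak h]\subseteq\mathfrak h$, $[\mathfrak h,\mathfrak m]\subseteq\mathfrak m$, $[\mathfrak m,\mathfrak m]\subseteq\mathfrak h$, and there is $A\in\mathfrak h$ with centralizer $\mathfrak h$ in $\mathfrak g$ such that $J=\mathrm{ad}(A)$ satisfies $J^2=-1$ on $\mathfrak m$. Let $H\subset G$ be the stabilizer of $A$, let $\langle\cdot,\cdot\rangle$ be the Killing form of $\mathfrak g$, and put $\chi=-\langle A,A\rangle>0$. For an $\mathfrak m$-valued variable $u$ with jets $(u,u_x,u_{xx},\dots)$ let $D$ be the total derivative on smooth functions of finitely many jet variables, and let $D^{-1}f$ be the differential function $p$ with $Dp=f$ and $p=0$ at the zero jet (zero constant of integration). Put $\mathcal H_u=D-\mathrm{ad}(u)D^{-1}\mathrm{ad}(u)$, $\mathcal R_u=\mathcal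 H_uJ^{-1}$, $\mathcal R_u^*=J^{-1}\mathcal H_u$, $\mathcal J_u=J\mathcal H_uJ^{-1}$. All functions of $(x,t)$ or $(s,t)$ below are smooth, with space variable in $\mathbb R$ (periodic functions being a special case) and with time in an open interval. The merged hierarchy on $q(x,t)\in\mathfrak m$ consists of the flows $\chi^{-1}q_t=\mathcal R_q^n(Jq)$, and the isospectral hierarchy on $Q(s,t)\in\mathfrak m$ of the flows $Q_t=\mathcal R_Q^n(JQ)$, $n=0,1,2,\dots$ (the "$+n$ flows"). Put $\kappa=\chi^{n/2-1}$ and let $q$ and $Q$ be related by $$x=\chi^{1/2}s,\qquad q(x,\kappa t)=-\chi^{-1/2}Q(s,t).$$ 1. For every $n$, $\mathcal R_u^n(Ju)$ is a well-defined $\mathfrak m$-valued differential function, and $[u,J^{-1}\mathcal R_u^n(Ju)]$ has a unique primitive with zero constant of integration. $Q$ solves the $+n$ isospectral flow if and only if $U_t-V_s+[U,V]=0$ for all $\lambda\in\mathbb R$, where $U=\lambda A+Q$, $V=\lambda^nA+\sum_{k=0}^{n-1}\lambda^k(V^{(k)}_{\mathfrak m}+V^{(k)}_{\mathfrak h})$,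 $V^{(k)}_{\mathfrak m}=(\mathcal R_Q^*)^{n-1-k}(Q)$, $V^{(k)}_{\mathfrak h}=D^{-1}[Q,V^{(k)}_{\mathfrak m}]$. 2. For every $n$, $q$ solves the $+n$ flow of the merged hierarchy on a time interval $I$ if and only if $Q$ solves the $+n$ isospectral flow on $\{t:\kappa t\in I\}$. 3. The $+2$ flows on $q$ and on $Q$ are the NLS systems $$\chi^{-1}q_t=-Jq_{xx}+\tfrac12[q,[q,Jq]],\qquad Q_t=-JQ_{ss}+\tfrac12[Q,[Q,JQ]],$$ and the $+3$ flows are the mKdV systems $$\chi^{-1}q_t=-q_{xxx}+[q,[q,q_x]]+\tfrac12[Jq,[Jq,q]]_x,\qquad Q_t=-Q_{sss}+[Q,[Q,Q_s]]+\tfrac12[JQ,[JQ,Q]]_s .$$ These systems are invariant under $\mathrm{Ad}(H)$. 4. Let $n\ge2$ and let $Q$ solve the $+n$ isospectral flow. The $+n$ flow on $q$ determines the quantities $h^\perp=-\mathcal R_q^{n-2}(Jq)$, $h_\perp=\chi^{1/2}J^{-1}h^\perp$, $h_\parallel=\chi^{1/2}D^{-1}[q,Jh^\perp]$, $w_\perp=\chi\mathcal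 J_q(h^\perp)$, $w_\parallel=-D^{-1}[q,w_\perp]$. Then $V^{(1)}_{\mathfrak m}=\kappa h_\perp$, $V^{(1)}_{\mathfrak h}=\kappa h_\parallel$, $V^{(0)}_{\mathfrak m}=-\kappa w_\perp$, $V^{(0)}_{\mathfrak h}=-\kappa w_\parallel$ at corresponding points $(s,t)$ and $(x,\kappa t)$. A curve flow $\gamma(x,t)$ in the affine symmetric space $(G\ltimes\mathfrak g)/G$, identified with the Euclidean space $(\mathfrak g,-\langle\cdot,\cdot\rangle)$, is called a non-stretching curve flow determined by the $+n$ flow on $q$, with frame $\psi(x,t)\in G$, if $x$ is its arclength and $$\mathrm{Ad}(\psi^{-1})\gamma_x=\chi^{-1/2}A,\quad \psi^{-1}\psi_x=q,\quad \mathrm{Ad}(\psi^{-1})\gamma_t=h_\perp+h_\parallel,\quad \psi^{-1}\psi_t=w_\perp+w_\parallel,$$ where $q$ solves the $+n$ flow. Let $\varphi(s,t,\lambda)\in G$ ($\lambda\in\mathbb R$) be any smooth solution of $\varphi_s=U\varphi$, $\varphi_t=V\varphi$, and let $\Gamma(s,t)=\varphi^{-1}\varphi_\lambda|_{\lambda=0}$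 be its Sym–Pohlmeyer curve. Then $\gamma(x,\kappa t)=\Gamma(s,t)$ lies in $\mathfrak g$ and is a non-stretching curve flow determined by the $+n$ flow on $q$, with frame $\psi(x,\kappa t)=\varphi(s,t,0)^{-1}$. Conversely, every non-stretching curve flow determined by the $+n$ flow on $q$ is of the form $\gamma(x,\kappa t)=g\,\Gamma(s,t)\,g^{-1}+a$ with constant $g\in G$, $a\in\mathfrak g$. -/

import Mathlib

open scoped ContDiff

attribute [local instance] LieRing.ofAssociativeRing

noncomputable section

/-- A Hermitian symmetric Lie algebra `(𝔤 = 𝔪 ⊕ 𝔥, A)` together with a compact semisimple Lie group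
`G` with Lie algebra `𝔤`. As compact Lie groups are linear, `G` is taken to be a compact group of
units of a finite-dimensional real associative algebra `𝔸` (for instance a matrix algebra), so that
`Ad(g) X = g X g⁻¹` and the Lie bracket is the commutator. The symmetric space is assumed to have
positive dimension (`𝔪 ≠ 0`). -/
structure HermitianSymmetric (𝔸 : Type*) [NormedRing 𝔸] [NormedAlgebra ℝ 𝔸] where
  /-- the compact group -/
  G : Subgroup 𝔸ˣ
  isCompact_G : IsCompact (G : Set 𝔸ˣ)
  /-- the Lie algebra of `G` -/
  𝔤 : LieSubalgebra ℝ 𝔸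
  mem_𝔤_iff : ∀ X : 𝔸, X ∈ 𝔤 ↔ ∀ r : ℝ, ∃ g ∈ G, (g : 𝔸) = NormedSpace.exp (r • X)
  isSemisimple : LieAlgebra.IsSemisimple ℝ 𝔤
  /-- the isotropy subalgebra -/
  𝔥 : Submodule ℝ 𝔸
  /-- the complementary subspace -/
  𝔪 : Submodule ℝ 𝔸
  sup_eq : 𝔥 ⊔ 𝔪 = 𝔤.toSubmodule
  disjoint : Disjoint 𝔥 𝔪
  lie_𝔥_𝔥 : ∀ X ∈ 𝔥, ∀ Y ∈ 𝔥, ⁅X, Y⁆ ∈ 𝔥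
  lie_𝔥_𝔪 : ∀ X ∈ 𝔥, ∀ Y ∈ 𝔪, ⁅X, Y⁆ ∈ 𝔪
  lie_𝔪_𝔪 : ∀ X ∈ 𝔪, ∀ Y ∈ 𝔪, ⁅X, Y⁆ ∈ 𝔥
  /-- the element defining the complex structure `J = ad(A)` on `𝔪` -/
  A : 𝔸
  A_mem : A ∈ 𝔥
  centralizer_A : ∀ X ∈ 𝔤, ⁅A, X⁆ = 0 ↔ X ∈ 𝔥
  ad_A_sq : ∀ X ∈ 𝔪, ⁅A, ⁅A, X⁆⁆ = -X
  𝔪_ne_bot : 𝔪 ≠ ⊥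

namespace HermitianSymmetric

variable {𝔸 : Type*} [NormedRing 𝔸] [NormedAlgebra ℝ 𝔸] (S : HermitianSymmetric 𝔸)

theorem A_mem_𝔤 : S.A ∈ S.𝔤 := by
  have h : S.A ∈ S.𝔤.toSubmodule := S.sup_eq ▸ Submodule.mem_sup_left S.A_mem
  exact h

/-- The constant `χ = -⟨A, A⟩`, the squared norm of `A` with respect to minus the Killing form. -/
def χ : ℝ := -(killingForm ℝ S.𝔤 ⟨S.A, S.A_mem_𝔤⟩ ⟨S.A, S.A_mem_𝔤⟩)

/-- The stabilizer group `H` of `A` in `G`. -/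
def H : Subgroup 𝔸ˣ where
  carrier := {g | g ∈ S.G ∧ (g : 𝔸) * S.A = S.A * (g : 𝔸)}
  one_mem' := ⟨S.G.one_mem, by simp⟩
  mul_mem' := by
    rintro a b ⟨ha, ha'⟩ ⟨hb, hb'⟩
    refine ⟨S.G.mul_mem ha hb, ?_⟩
    rw [Units.val_mul, mul_assoc, hb', ← mul_assoc, ha', mul_assoc]
  inv_mem' := by
    rintro a ⟨ha, ha'⟩
    exact ⟨S.G.inv_mem ha, (Units.inv_mul_eq_iff_eq_mul a).mpr
      (by rw [← mul_assoc, ha', mul_assoc, Units.mul_inv, mul_one])⟩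

/-! ### Differential functions on the jet space of `𝔪`-valued functions -/

/-- Jets `(u, u_x, u_xx, …)` of `𝔪`-valued functions of one variable. -/
abbrev Jet : Type _ := ℕ → S.𝔪

/-- The jet at `x` of a function `f`. -/
def jet (f : ℝ → S.𝔪) (x : ℝ) : S.Jet := fun k => iteratedDeriv k f x

/-- `F` is a smooth function of finitely many of the jet variables. -/
def IsDifferential (F : S.Jet → 𝔸) : Prop :=
  ∃ (N : ℕ) (f : (Fin N → S.𝔪) → 𝔸), ContDiff ℝ ∞ f ∧ ∀ u, F u = f (fun i => u i)

/-- The total derivative `D F = ∑ₖ ∂F/∂uₖ · uₖ₊₁`, as the derivative of `F` at `u` in the direction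
of the shifted jet. -/
def D (F : S.Jet → 𝔸) : S.Jet → 𝔸 := fun u =>
  deriv (fun ε : ℝ => F (fun k => u k + ε • u (k + 1))) 0

/-- `p` is the formal primitive of `f`: a differential function with `D p = f` and with zero
constant of integration. -/
def IsPrimitive (p f : S.Jet → 𝔸) : Prop :=
  S.IsDifferential p ∧ S.D p = f ∧ p 0 = 0

open Classical in
/-- The formal inverse `D⁻¹` of the total derivative (with the value `0` on functions which are not
total derivatives). -/
def Dinv (f : S.Jet → 𝔸) : S.Jet → 𝔸 :=
  if h : ∃ p, S.IsPrimitive p f then h.choose else 0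

/-! ### The operators, with `J = ad(A)`, and `J⁻¹ = -J` on `𝔪` -/

/-- `J = ad(A)`. -/
def J (F : S.Jet → 𝔸) : S.Jet → 𝔸 := fun u => ⁅S.A, F u⁆

/-- `J⁻¹ = -ad(A)` (inverse to `J` on `𝔪`-valued functions). -/
def Jinv (F : S.Jet → 𝔸) : S.Jet → 𝔸 := fun u => -⁅S.A, F u⁆

/-- The jet variable `u` itself. -/
def var : S.Jet → 𝔸 := fun u => (u 0 : 𝔸)

/-- `ad(u)`. -/
def adVar (F : S.Jet → 𝔸) : S.Jet → 𝔸 := fun u => ⁅(u 0 : 𝔸), F u⁆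

/-- The operator `ℋ = D - ad(u) D⁻¹ ad(u)`. -/
def Hop (F : S.Jet → 𝔸) : S.Jet → 𝔸 := S.D F - S.adVar (S.Dinv (S.adVar F))

/-- The operator `𝒥 = J ℋ J⁻¹`. -/
def Jop (F : S.Jet → 𝔸) : S.Jet → 𝔸 := S.J (S.Hop (S.Jinv F))

/-- The recursion operator `ℛ = ℋ J⁻¹`. -/
def Rop (F : S.Jet → 𝔸) : S.Jet → 𝔸 := S.Hop (S.Jinv F)

/-- The adjoint recursion operator `ℛ* = J⁻¹ ℋ`. -/
def RopAdj (F : S.Jet → 𝔸) : S.Jet → 𝔸 := S.Jinv (S.Hop F)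

/-- `ℛⁿ(J u)`. -/
def hier (n : ℕ) : S.Jet → 𝔸 := S.Rop^[n] (S.J S.var)

/-! ### The flows; `I` is an open interval of times -/

/-- `q(x,t) ∈ 𝔪` is smooth for `x ∈ ℝ`, `t ∈ I`. -/
def SmoothOn (I : Set ℝ) (q : ℝ → ℝ → S.𝔪) : Prop :=
  ContDiffOn ℝ ∞ (fun p : ℝ × ℝ => q p.1 p.2) (Set.univ ×ˢ I)

/-- `q` is a smooth solution of the `+n` flow `χ⁻¹ q_t = ℛⁿ(J q)` of the merged hierarchy. -/
def MergedFlow (n : ℕ) (I : Set ℝ) (q : ℝ → ℝ → S.𝔪) : Prop :=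
  S.SmoothOn I q ∧ ∀ x, ∀ t ∈ I,
    S.χ⁻¹ • (deriv (fun τ => q x τ) t : 𝔸) = S.hier n (S.jet (fun y => q y t) x)

/-- `Q` is a smooth solution of the `+n` isospectral flow `Q_t = ℛⁿ(J Q)`. -/
def IsospectralFlow (n : ℕ) (I : Set ℝ) (Q : ℝ → ℝ → S.𝔪) : Prop :=
  S.SmoothOn I Q ∧ ∀ s, ∀ t ∈ I,
    (deriv (fun τ => Q s τ) t : 𝔸) = S.hier n (S.jet (fun y => Q y t) s)

/-- `c⁻¹ q_t = -J q_xx + ½ [q, [q, J q]]`. -/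
def NLS (c : ℝ) (I : Set ℝ) (q : ℝ → ℝ → S.𝔪) : Prop :=
  S.SmoothOn I q ∧ ∀ x, ∀ t ∈ I,
    c⁻¹ • (deriv (fun τ => q x τ) t : 𝔸) =
      -⁅S.A, (iteratedDeriv 2 (fun y => q y t) x : 𝔸)⁆
        + (1 / 2 : ℝ) • ⁅(q x t : 𝔸), ⁅(q x t : 𝔸), ⁅S.A, (q x t : 𝔸)⁆⁆⁆

/-- `c⁻¹ q_t = -q_xxx + [q, [q, q_x]] + ½ [J q, [J q, q]]_x`. -/
def MKdV (c : ℝ) (I : Set ℝ) (q : ℝ → ℝ → S.𝔪) : Prop :=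
  S.SmoothOn I q ∧ ∀ x, ∀ t ∈ I,
    c⁻¹ • (deriv (fun τ => q x τ) t : 𝔸) =
      -(iteratedDeriv 3 (fun y => q y t) x : 𝔸)
        + ⁅(q x t : 𝔸), ⁅(q x t : 𝔸), (deriv (fun y => q y t) x : 𝔸)⁆⁆
        + (1 / 2 : ℝ) • deriv (fun y =>
            ⁅⁅S.A, (q y t : 𝔸)⁆, ⁅⁅S.A, (q y t : 𝔸)⁆, (q y t : 𝔸)⁆⁆) x

/-! ### The Lax pair `U = λ A + Q`, `V = ∑ λᵏ V⁽ᵏ⁾` of the `+n` isospectral flow -/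

/-- The `𝔪`-part of `V⁽ᵏ⁾` for `k < n`, namely `(ℛ*)ⁿ⁻¹⁻ᵏ(Q)`. -/
def laxVm (n k : ℕ) : S.Jet → 𝔸 := S.RopAdj^[n - 1 - k] S.var

/-- The `𝔥`-part of `V⁽ᵏ⁾` for `k < n`, determined by `D V_𝔥 = [Q, V_𝔪]` with zero constant of
integration. -/
def laxVh (n k : ℕ) : S.Jet → 𝔸 := S.Dinv (S.adVar (S.laxVm n k))

/-- `U(λ) = λ A + Q`. -/
def laxU (l : ℝ) : S.Jet → 𝔸 := fun u => l • S.A + (u 0 : 𝔸)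

/-- `V(λ) = λⁿ A + ∑_{k<n} λᵏ (V⁽ᵏ⁾_𝔪 + V⁽ᵏ⁾_𝔥)`. -/
def laxV (n : ℕ) (l : ℝ) : S.Jet → 𝔸 := fun u =>
  l ^ n • S.A + ∑ k ∈ Finset.range n, l ^ k • (S.laxVm n k u + S.laxVh n k u)

/-- The zero-curvature equation `U_t - V_s + [U, V] = 0` for all `λ`. -/
def ZeroCurvature (n : ℕ) (I : Set ℝ) (Q : ℝ → ℝ → S.𝔪) : Prop :=
  ∀ s, ∀ t ∈ I, ∀ l : ℝ,
    deriv (fun τ => S.laxU l (S.jet (fun y => Q y τ) s)) t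
      - deriv (fun σ => S.laxV n l (S.jet (fun y => Q y t) σ)) s
      + ⁅S.laxU l (S.jet (fun y => Q y t) s), S.laxV n l (S.jet (fun y => Q y t) s)⁆ = 0

/-- `φ(s,t,λ) ∈ G` is a smooth solution of the linear system `φ_s = U φ`, `φ_t = V φ`. -/
structure IsSpectralFunction (n : ℕ) (I : Set ℝ) (Q : ℝ → ℝ → S.𝔪) (φ : ℝ → ℝ → ℝ → 𝔸ˣ) :
    Prop where
  mem_G : ∀ s, ∀ t ∈ I, ∀ l, φ s t l ∈ S.G
  smooth : ContDiffOn ℝ ∞ (fun p : ℝ × ℝ × ℝ => (φ p.1 p.2.1 p.2.2 : 𝔸))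
    (Set.univ ×ˢ (I ×ˢ Set.univ))
  deriv_s : ∀ s, ∀ t ∈ I, ∀ l, deriv (fun σ => (φ σ t l : 𝔸)) s =
    S.laxU l (S.jet (fun y => Q y t) s) * (φ s t l : 𝔸)
  deriv_t : ∀ s, ∀ t ∈ I, ∀ l, deriv (fun τ => (φ s τ l : 𝔸)) t =
    S.laxV n l (S.jet (fun y => Q y t) s) * (φ s t l : 𝔸)

/-- The Sym–Pohlmeyer curve `φ⁻¹ φ_λ` at `λ = 0`. -/
def symPohlmeyer (φ : ℝ → ℝ → ℝ → 𝔸ˣ) (s t : ℝ) : 𝔸 :=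
  ((φ s t 0)⁻¹ : 𝔸ˣ) * deriv (fun l => (φ s t l : 𝔸)) 0

/-! ### The non-stretching curve flow determined by the `+n` flow, `n ≥ 2`

`h^⊥` is `-ℛⁿ⁻²(J q)`, so that the frame structure equations, which give `χ⁻¹ q_t = -ℛ²(h^⊥)`, yield
the `+n` flow. -/

/-- `h^⊥ = -ℛⁿ⁻²(J q)`. -/
def hUp (n : ℕ) : S.Jet → 𝔸 := -S.hier (n - 2)

/-- `h_⊥ = χ^{1/2} J⁻¹ h^⊥`, i.e. `h^⊥ = χ^{-1/2} [A, h_⊥]`. -/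
def hPerp (n : ℕ) : S.Jet → 𝔸 := √S.χ • S.Jinv (S.hUp n)

/-- `h_∥ = χ^{1/2} D⁻¹ [q, J h^⊥]`. -/
def hPar (n : ℕ) : S.Jet → 𝔸 := √S.χ • S.Dinv (S.adVar (S.J (S.hUp n)))

/-- `w_⊥ = χ 𝒥(h^⊥)`. -/
def wPerp (n : ℕ) : S.Jet → 𝔸 := S.χ • S.Jop (S.hUp n)

/-- `w_∥ = -D⁻¹ [q, w_⊥]`. -/
def wPar (n : ℕ) : S.Jet → 𝔸 := -S.Dinv (S.adVar (S.wPerp n))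

/-- `γ(x,t)` is a non-stretching curve flow (`x` being arclength) in the affine symmetric space
`(G ⋉ 𝔤)/G`, which is identified with the Euclidean space `𝔤` with the metric `-⟨·,·⟩`, framed by
`ψ(x,t) ∈ G` through the coframe `e = Ad(ψ⁻¹)` and the connection `ω = ψ⁻¹ dψ`. The frame is
`G`-parallel with `e_x = χ^{-1/2} A` and `ω_x = q ∈ 𝔪`, and the flow is the one determined by the
`+n` flow on `q`: `e_t = h_⊥ + h_∥` and `ω_t = w_⊥ + w_∥`. -/
structure IsCurveFlow (n : ℕ) (I : Set ℝ) (q : ℝ → ℝ → S.𝔪) (ψ : ℝ → ℝ → 𝔸ˣ)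
    (γ : ℝ → ℝ → S.𝔤) : Prop where
  flow : S.MergedFlow n I q
  mem_G : ∀ x, ∀ t ∈ I, ψ x t ∈ S.G
  smooth_frame : ContDiffOn ℝ ∞ (fun p : ℝ × ℝ => (ψ p.1 p.2 : 𝔸)) (Set.univ ×ˢ I)
  smooth_curve : ContDiffOn ℝ ∞ (fun p : ℝ × ℝ => γ p.1 p.2) (Set.univ ×ˢ I)
  arclength : ∀ x, ∀ t ∈ I,
    -(killingForm ℝ S.𝔤 (deriv (fun y => γ y t) x) (deriv (fun y => γ y t) x)) = 1
  e_x : ∀ x, ∀ t ∈ I, ((ψ x t)⁻¹ : 𝔸ˣ) * (deriv (fun y => γ y t) x : 𝔸) * (ψ x t : 𝔸) =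
    (√S.χ)⁻¹ • S.A
  ω_x : ∀ x, ∀ t ∈ I, ((ψ x t)⁻¹ : 𝔸ˣ) * deriv (fun y => (ψ y t : 𝔸)) x = q x t
  e_t : ∀ x, ∀ t ∈ I, ((ψ x t)⁻¹ : 𝔸ˣ) * (deriv (fun τ => γ x τ) t : 𝔸) * (ψ x t : 𝔸) =
    S.hPerp n (S.jet (fun y => q y t) x) + S.hPar n (S.jet (fun y => q y t) x)
  ω_t : ∀ x, ∀ t ∈ I, ((ψ x t)⁻¹ : 𝔸ˣ) * deriv (fun τ => (ψ x τ : 𝔸)) t =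
    S.wPerp n (S.jet (fun y => q y t) x) + S.wPar n (S.jet (fun y => q y t) x)

/-! ### The transformation -/

/-- The factor `κ = χ^{n/2-1}` between the two time variables of the `+n` flow (`κ = 1` for
`n = 2`). -/
def κ (n : ℕ) : ℝ := S.χ ^ ((n : ℝ) / 2 - 1)

/-- `q(x, κ t) = -χ^{-1/2} Q(s, t)` where `x = χ^{1/2} s`. -/
def Corresponds (n : ℕ) (q Q : ℝ → ℝ → S.𝔪) : Prop :=
  ∀ s t, q (√S.χ * s) (S.κ n * t) = -((√S.χ)⁻¹ • Q s t)

/-- The interval of isospectral times `t` with `κ t ∈ I`. -/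
def isoTimes (n : ℕ) (I : Set ℝ) : Set ℝ := {t | S.κ n * t ∈ I}

end HermitianSymmetric

end

/-!
The member `ℛⁿ(Ju)` of the hierarchy is `J` of the `𝔪`-part of the coefficient of `λ⁻ⁿ⁻¹` in the
solution `V = A + O(λ⁻¹)` of `D V = [λ A + u, V]`: the `𝔥`-part of each coefficient is a primitive
of the bracket of `u` with its `𝔪`-part, and eliminating the `𝔥`-parts leaves the recursion by `ℛ*`.
That these primitives are again differential functions is seen by dressing: in the adjoint
representation `a = ad A` satisfies `a³ = -a`, so `ad a` is invertible on its image and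
`D V = [λ a + ad u, V]` is solved by `V = T a T⁻¹`, where `T` is a power series in `λ⁻¹` whose
coefficients are differential functions; an equivariant retraction of `End 𝔤` onto `𝔤`, provided by
the Killing form, carries this solution to `𝔤`. Truncating `λⁿ V` to its polynomial part gives the
Lax pair.

The coefficients of `V` are homogeneous under `u(x) ↦ r u(r x)` and, up to sign, under `u ↦ -u`;
this matches the two hierarchies and accounts for the powers of `χ`.

Differentiating `φ_s = U φ`, `φ_t = V φ` with respect to `λ` at `λ = 0` shows that `φ⁻¹` is a frame
along the Sym–Pohlmeyer curve whose equations are, after rescaling, those of the curve flow. Two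
frames with the same connection differ by a constant left translation, hence two such curves by a
rigid motion.
-/

noncomputable section

section DifferentialFunctions

variable {M W W₁ W₂ E : Type*} [NormedAddCommGroup M] [NormedSpace ℝ M]
  [NormedAddCommGroup W] [NormedSpace ℝ W] [NormedAddCommGroup W₁] [NormedSpace ℝ W₁]
  [NormedAddCommGroup W₂] [NormedSpace ℝ W₂] [NormedRing E] [NormedAlgebra ℝ E]

/-- A differential function: a smooth function of finitely many of the jet variables
`(u, u_x, u_xx, …)` of an `M`-valued function. For `M = 𝔪` and values in `𝔸` this is
`HermitianSymmetric.IsDifferential`; other value spaces are needed for functions with values in the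
endomorphisms of `𝔤`. -/
def IsDiffFun (F : (ℕ → M) → W) : Prop :=
  ∃ (N : ℕ) (f : (Fin N → M) → W), ContDiff ℝ ∞ f ∧ ∀ u, F u = f (fun i => u i)

/-- The total derivative of a differential function, encoded as `HermitianSymmetric.D`: the
derivative in the direction of the shifted jet. -/
def totalDeriv (F : (ℕ → M) → W) : (ℕ → M) → W := fun u =>
  deriv (fun ε : ℝ => F (fun k => u k + ε • u (k + 1))) 0

namespace IsDiffFun

variable {F G : (ℕ → M) → W}

theorem exists_forall_ge (hF : IsDiffFun F) : ∃ N : ℕ, ∀ N', N ≤ N' →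
    ∃ f : (Fin N' → M) → W, ContDiff ℝ ∞ f ∧ ∀ u, F u = f (fun i => u i) := by
  obtain ⟨N, f, hf, h⟩ := hF
  refine ⟨N, fun N' hN => ⟨fun v => f (fun i => v (Fin.castLE hN i)), ?_, fun u => by simp [h]⟩⟩
  exact hf.comp (contDiff_pi.2 fun i => contDiff_apply ℝ M _)

theorem eval (k : ℕ) : IsDiffFun (fun u : ℕ → M => u k) :=
  ⟨k + 1, fun v => v (Fin.last k), contDiff_apply ℝ M _, fun u => by simp⟩

theorem const (c : W) : IsDiffFun (fun _ : ℕ → M => c) :=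
  ⟨0, fun _ => c, contDiff_const, fun _ => rfl⟩

theorem contDiff_comp (hF : IsDiffFun F) {Φ : W → W₁} (hΦ : ContDiff ℝ ∞ Φ) :
    IsDiffFun (fun u => Φ (F u)) := by
  obtain ⟨N, f, hf, h⟩ := hF
  exact ⟨N, fun v => Φ (f v), hΦ.comp hf, fun u => by simp only [h]⟩

theorem prodMk {G : (ℕ → M) → W₁} (hF : IsDiffFun F) (hG : IsDiffFun G) :
    IsDiffFun (fun u => (F u, G u)) := by
  obtain ⟨N₁, hF⟩ := hF.exists_forall_ge
  obtain ⟨N₂, hG⟩ := hG.exists_forall_ge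
  obtain ⟨f, hf, hFf⟩ := hF (max N₁ N₂) (le_max_left _ _)
  obtain ⟨g, hg, hGg⟩ := hG (max N₁ N₂) (le_max_right _ _)
  exact ⟨max N₁ N₂, fun v => (f v, g v), hf.prodMk hg, fun u => Prod.ext (hFf u) (hGg u)⟩

theorem clm (hF : IsDiffFun F) (L : W →L[ℝ] W₁) : IsDiffFun (fun u => L (F u)) :=
  hF.contDiff_comp L.contDiff

theorem neg (hF : IsDiffFun F) : IsDiffFun (fun u => -F u) :=
  hF.contDiff_comp contDiff_neg

theorem const_smul (hF : IsDiffFun F) (c : ℝ) : IsDiffFun (fun u => c • F u) :=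
  hF.contDiff_comp (contDiff_const_smul c)

theorem add (hF : IsDiffFun F) (hG : IsDiffFun G) : IsDiffFun (fun u => F u + G u) :=
  (hF.prodMk hG).contDiff_comp contDiff_add

theorem sub (hF : IsDiffFun F) (hG : IsDiffFun G) : IsDiffFun (fun u => F u - G u) :=
  (hF.prodMk hG).contDiff_comp (contDiff_fst.sub contDiff_snd)

theorem mul {F G : (ℕ → M) → E} (hF : IsDiffFun F) (hG : IsDiffFun G) :
    IsDiffFun (fun u => F u * G u) :=
  (hF.prodMk hG).contDiff_comp contDiff_mul

theorem lie {F G : (ℕ → M) → E} (hF : IsDiffFun F) (hG : IsDiffFun G) :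
    IsDiffFun (fun u => ⁅F u, G u⁆) :=
  (hF.mul hG).sub (hG.mul hF)

theorem comp_smul (hF : IsDiffFun F) (a : ℕ → ℝ) :
    IsDiffFun (fun u => F (fun k => a k • u k)) := by
  obtain ⟨N, f, hf, h⟩ := hF
  refine ⟨N, fun v => f (fun i => a i • v i), hf.comp (contDiff_pi.2 fun i => ?_),
    fun u => by simp only [h]⟩
  exact (contDiff_apply ℝ M i).const_smul _

end IsDiffFun

theorem hasDerivAt_add_smul_shift (N : ℕ) (u : ℕ → M) (ε : ℝ) :
    HasDerivAt (fun (ε : ℝ) (i : Fin N) => u i + ε • u (i + 1)) (fun i => u (i + 1)) ε := by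
  refine hasDerivAt_pi.2 fun i => ?_
  simpa using ((hasDerivAt_id ε).smul_const (u (i + 1))).const_add (u i)

theorem totalDeriv_eq_fderiv {F : (ℕ → M) → W} {N : ℕ} {f : (Fin N → M) → W}
    (hf : ContDiff ℝ ∞ f) (h : ∀ u, F u = f (fun i => u i)) (u : ℕ → M) :
    totalDeriv F u = fderiv ℝ f (fun i => u i) (fun i => u (i + 1)) := by
  have hf' : HasFDerivAt f (fderiv ℝ f (fun i => u i))
      (fun i : Fin N => u i + (0 : ℝ) • u (i + 1)) := by
    simpa using (hf.differentiable (by simp)).differentiableAt.hasFDerivAt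
  rw [totalDeriv, ← (hf'.comp_hasDerivAt (0 : ℝ) (hasDerivAt_add_smul_shift N u 0)).deriv]
  simp only [h, Function.comp_def]

namespace IsDiffFun

variable {F G : (ℕ → M) → W}

theorem totalDeriv (hF : IsDiffFun F) : IsDiffFun (totalDeriv F) := by
  obtain ⟨N, f, hf, h⟩ := hF
  refine ⟨N + 1, fun v => fderiv ℝ f (fun i => v i.castSucc) (fun i => v i.succ), ?_, fun u => ?_⟩
  · refine ContDiff.clm_apply (ContDiff.comp (hf.fderiv_right (m := ∞) (by simp)) ?_) ?_ <;>
      exact contDiff_pi.2 fun i => contDiff_apply ℝ M _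
  · simp [totalDeriv_eq_fderiv hf h]

theorem hasDerivAt (hF : IsDiffFun F) (u : ℕ → M) :
    HasDerivAt (fun ε : ℝ => F (fun k => u k + ε • u (k + 1))) (_root_.totalDeriv F u) 0 := by
  refine DifferentiableAt.hasDerivAt ?_
  obtain ⟨N, f, hf, h⟩ := hF
  simp only [h]
  exact DifferentiableAt.comp (g := f) 0 (hf.differentiable (by simp)).differentiableAt
    (hasDerivAt_add_smul_shift N u 0).differentiableAt

theorem hasDerivAt_jet (hF : IsDiffFun F) {f : ℝ → M} (hf : ContDiff ℝ ∞ f) (x : ℝ) :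
    HasDerivAt (fun y => F (fun k => iteratedDeriv k f y))
      (_root_.totalDeriv F (fun k => iteratedDeriv k f x)) x := by
  obtain ⟨N, g, hg, h⟩ := hF
  rw [totalDeriv_eq_fderiv hg h]
  simp only [h]
  refine HasFDerivAt.comp_hasDerivAt (l := g) x
    (hg.differentiable (by simp)).differentiableAt.hasFDerivAt (hasDerivAt_pi.2 fun i => ?_)
  rw [iteratedDeriv_succ]
  exact (hf.differentiable_iteratedDeriv i
    (by exact_mod_cast ENat.natCast_lt_top _) x).hasDerivAt

end IsDiffFun

section TotalDeriv

variable {F G : (ℕ → M) → W}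

theorem totalDeriv_const (c : W) (u : ℕ → M) : totalDeriv (fun _ : ℕ → M => c) u = 0 := by
  simp [totalDeriv]

theorem totalDeriv_zero_jet (F : (ℕ → M) → W) : totalDeriv F 0 = 0 := by
  simp [totalDeriv]

theorem totalDeriv_eval (k : ℕ) (u : ℕ → M) :
    totalDeriv (fun u : ℕ → M => u k) u = u (k + 1) := by
  have hderiv := (((hasDerivAt_id (0 : ℝ)).smul_const (u (k + 1))).const_add (u k)).deriv
  rwa [one_smul] at hderiv

theorem totalDeriv_add (hF : IsDiffFun F) (hG : IsDiffFun G) (u : ℕ → M) :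
    totalDeriv (fun u => F u + G u) u = totalDeriv F u + totalDeriv G u :=
  ((hF.hasDerivAt u).add (hG.hasDerivAt u)).deriv

theorem totalDeriv_sub (hF : IsDiffFun F) (hG : IsDiffFun G) (u : ℕ → M) :
    totalDeriv (fun u => F u - G u) u = totalDeriv F u - totalDeriv G u :=
  ((hF.hasDerivAt u).sub (hG.hasDerivAt u)).deriv

theorem totalDeriv_clm (hF : IsDiffFun F) (L : W →L[ℝ] W₁) (u : ℕ → M) :
    totalDeriv (fun u => L (F u)) u = L (totalDeriv F u) :=
  (L.hasFDerivAt.comp_hasDerivAt (0 : ℝ) (hF.hasDerivAt u)).deriv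

theorem totalDeriv_neg (F : (ℕ → M) → W) (u : ℕ → M) :
    totalDeriv (fun u => -F u) u = -totalDeriv F u :=
  deriv.fun_neg

theorem totalDeriv_const_smul (hF : IsDiffFun F) (c : ℝ) (u : ℕ → M) :
    totalDeriv (fun u => c • F u) u = c • totalDeriv F u :=
  ((hF.hasDerivAt u).const_smul c).deriv

theorem totalDeriv_mul {F G : (ℕ → M) → E} (hF : IsDiffFun F) (hG : IsDiffFun G) (u : ℕ → M) :
    totalDeriv (fun u => F u * G u) u = totalDeriv F u * G u + F u * totalDeriv G u := by
  have hderiv := ((hF.hasDerivAt u).mul (hG.hasDerivAt u)).deriv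
  simp only [zero_smul, add_zero] at hderiv
  exact hderiv

theorem totalDeriv_lie {F G : (ℕ → M) → E} (hF : IsDiffFun F) (hG : IsDiffFun G) (u : ℕ → M) :
    totalDeriv (fun u => ⁅F u, G u⁆) u = ⁅totalDeriv F u, G u⁆ + ⁅F u, totalDeriv G u⁆ := by
  simp only [Ring.lie_def]
  rw [totalDeriv_sub (hF.mul hG) (hG.mul hF), totalDeriv_mul hF hG, totalDeriv_mul hG hF]
  abel

theorem totalDeriv_mem {K : Submodule ℝ W} [FiniteDimensional ℝ K] (h : ∀ u, F u ∈ K)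
    (u : ℕ → M) : totalDeriv F u ∈ K := by
  have hspan := range_deriv_subset_closure_span_image
    (fun ε : ℝ => F (fun k => u k + ε • u (k + 1))) dense_univ (Set.mem_range_self 0)
  refine K.closed_of_finiteDimensional.closure_subset_iff.2 ?_ hspan
  exact Submodule.span_le.2 (Set.image_subset_iff.2 fun ε _ => h _)

theorem totalDeriv_smul_pow (F : (ℕ → M) → W) (c r : ℝ) (u : ℕ → M) :
    totalDeriv F (fun k => (c * r ^ k) • u k) =
      r • totalDeriv (fun v => F (fun k => (c * r ^ k) • v k)) u := by
  have hshift : ∀ ε : ℝ, (fun k => (c * r ^ k) • u k + ε • (c * r ^ (k + 1)) • u (k + 1)) =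
      fun k => (c * r ^ k) • (u k + (r * ε) • u (k + 1)) := fun ε => by
    funext k
    module
  simp only [totalDeriv, hshift]
  simpa using deriv_comp_mul_left r
    (fun ε : ℝ => F (fun k => (c * r ^ k) • (u k + ε • u (k + 1)))) 0

end TotalDeriv

section KernelOfTotalDeriv

variable [CompleteSpace M]

theorem exists_contDiff_iteratedDeriv_eq (N : ℕ) (u : ℕ → M) :
    ∃ p : ℝ → M, ContDiff ℝ ∞ p ∧ ∀ i < N, iteratedDeriv i p 0 = u i := by
  induction N generalizing u with
  | zero => exact ⟨0, contDiff_const, by simp⟩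
  | succ N ih =>
    obtain ⟨p, hp, h⟩ := ih (fun k => u (k + 1))
    have hderiv : ∀ x, HasDerivAt (fun x => u 0 + ∫ y in (0 : ℝ)..x, p y) (p x) x := fun x =>
      (hp.continuous.integral_hasStrictDerivAt 0 x).hasDerivAt.const_add _
    have hderiv' : deriv (fun x => u 0 + ∫ y in (0 : ℝ)..x, p y) = p :=
      funext fun x => (hderiv x).deriv
    refine ⟨_, contDiff_infty_iff_deriv.2 ⟨fun x => (hderiv x).differentiableAt, ?_⟩, ?_⟩
    · rwa [hderiv']
    · rintro (_ | i) hi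
      · simp
      · rw [iteratedDeriv_succ', hderiv']
        exact h i (by omega)

theorem exists_contDiff_connecting_jet_zero (N : ℕ) (u : ℕ → M) :
    ∃ f : ℝ → M, ContDiff ℝ ∞ f ∧ (∀ i < N, iteratedDeriv i f 0 = u i) ∧
      ∀ i, iteratedDeriv i f 1 = 0 := by
  obtain ⟨p, hp, hpu⟩ := exists_contDiff_iteratedDeriv_eq N u
  let b : ContDiffBump (0 : ℝ) := ⟨1 / 4, 1 / 2, by norm_num, by norm_num⟩
  refine ⟨fun x => b x • p x, b.contDiff.smul hp, fun i hi => ?_, fun i => ?_⟩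
  · have hp_near : (fun x => b x • p x) =ᶠ[nhds 0] p := by
      filter_upwards [b.eventuallyEq_one] with x hx
      simp [hx]
    rw [hp_near.iteratedDeriv_eq, hpu i hi]
  · have hzero_near : (fun x => b x • p x) =ᶠ[nhds 1] fun _ => 0 := by
      filter_upwards [lt_mem_nhds (show (1 / 2 : ℝ) < 1 by norm_num)] with x hx
      rw [b.zero_of_le_dist, zero_smul]
      rw [Real.dist_eq, sub_zero]
      exact hx.le.trans (le_abs_self x)
    rw [hzero_near.iteratedDeriv_eq]
    simp

namespace IsDiffFun

variable {F G : (ℕ → M) → W}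

theorem eq_of_totalDeriv_eq_zero (hF : IsDiffFun F) (h0 : ∀ u, _root_.totalDeriv F u = 0)
    (u : ℕ → M) : F u = F 0 := by
  obtain ⟨N, g, -, h⟩ := id hF
  obtain ⟨f, hf, hf0, hf1⟩ := exists_contDiff_connecting_jet_zero N u
  have hconst := is_const_of_deriv_eq_zero (f := fun y => F (fun k => iteratedDeriv k f y))
    (fun y => (hF.hasDerivAt_jet hf y).differentiableAt)
    (fun y => (hF.hasDerivAt_jet hf y).deriv.trans (h0 _)) 0 1
  have hstart : F (fun k => iteratedDeriv k f 0) = F u := by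
    rw [h, h]
    exact congrArg g (funext fun i => hf0 i i.2)
  have hend : F (fun k => iteratedDeriv k f 1) = F 0 := congrArg F (funext hf1)
  exact hstart.symm.trans (hconst.trans hend)

theorem eq_of_totalDeriv_eq (hF : IsDiffFun F) (hG : IsDiffFun G)
    (h : _root_.totalDeriv F = _root_.totalDeriv G) (h0 : F 0 = G 0) : F = G := by
  funext u
  have := (hF.sub hG).eq_of_totalDeriv_eq_zero
    (fun u => by rw [totalDeriv_sub hF hG, h, sub_self]) u
  rwa [h0, sub_self, sub_eq_zero] at this

end IsDiffFun

end KernelOfTotalDeriv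

variable (M E)

/-- The algebra of differential functions with values in `E`. -/
def diffFunAlgebra : Subalgebra ℝ ((ℕ → M) → E) where
  carrier := {F | IsDiffFun F}
  mul_mem' hF hG := IsDiffFun.mul hF hG
  add_mem' hF hG := IsDiffFun.add hF hG
  algebraMap_mem' r := IsDiffFun.const (algebraMap ℝ E r)

namespace diffFunAlgebra

/-- The total derivative as an additive map on the algebra of differential functions. -/
def D : diffFunAlgebra M E →+ diffFunAlgebra M E where
  toFun F := ⟨totalDeriv F.1, IsDiffFun.totalDeriv F.2⟩
  map_zero' := Subtype.ext (funext (totalDeriv_const (0 : E)))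
  map_add' F G := Subtype.ext (funext (totalDeriv_add F.2 G.2))

/-- Evaluation of differential functions at the zero jet. -/
def evalZero : diffFunAlgebra M E →ₐ[ℝ] E :=
  (Pi.evalAlgHom ℝ (fun _ : ℕ → M => E) 0).comp (diffFunAlgebra M E).val

variable {M E}

theorem D_mul (F G : diffFunAlgebra M E) : D M E (F * G) = D M E F * G + F * D M E G :=
  Subtype.ext (funext (totalDeriv_mul F.2 G.2))

theorem evalZero_D (F : diffFunAlgebra M E) : evalZero M E (D M E F) = 0 :=
  totalDeriv_zero_jet F.1

end diffFunAlgebra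

end DifferentialFunctions

section Dressing

open PowerSeries

variable {R R' : Type*} [Ring R] [Ring R']

section AdCubic

variable {𝕜 : Type*} [Field 𝕜] [Algebra 𝕜 R] [Algebra 𝕜 R']

variable (𝕜) in
/-- A preimage under `ad a`, up to the centralizer of `a`, of an element of an algebra in which
`a³ = -a`. As the eigenvalues of `a` are `0, ±i`, those of `δ = ad a` are `0, ±i, ±2i`; hence
`δ⁵ + 5 δ³ + 4 δ = 0`, and `-(5 δ + δ³) / 4` inverts `δ` on its image. -/
def adPreimage (a x : R) : R :=
  -(5 / 4 : 𝕜) • ⁅a, x⁆ - (1 / 4 : 𝕜) • ⁅a, ⁅a, ⁅a, x⁆⁆⁆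

theorem ad_pow_five_of_cube_eq_neg {a : R} (ha : a * a * a = -a) (x : R) :
    ⁅a, ⁅a, ⁅a, ⁅a, ⁅a, x⁆⁆⁆⁆⁆ = -(5 • ⁅a, ⁅a, ⁅a, x⁆⁆⁆ + 4 • ⁅a, x⁆) := by
  have hleft : ∀ y, a * (a * (a * y)) = -(a * y) := fun y => by
    rw [← mul_assoc, ← mul_assoc, ha, neg_mul]
  have hright : a * (a * a) = -a := by rw [← mul_assoc, ha]
  simp only [Ring.lie_def, mul_sub, sub_mul, mul_assoc, hleft, hright, mul_neg, neg_mul, neg_neg]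
  abel

theorem commute_lie_adPreimage_sub [CharZero 𝕜] {a : R} (ha : a * a * a = -a) (x : R) :
    Commute a (⁅a, adPreimage 𝕜 a x⁆ - x) := by
  have hsmul : ∀ (c : 𝕜) (y : R), ⁅a, c • y⁆ = c • ⁅a, y⁆ := fun c y => by
    simp only [Ring.lie_def, mul_smul_comm, smul_mul_assoc, smul_sub]
  rw [commute_iff_lie_eq, adPreimage]
  simp only [lie_sub, hsmul]
  rw [ad_pow_five_of_cube_eq_neg ha]
  module

theorem map_adPreimage_of_commute (f : R →ₐ[𝕜] R') {a x : R} (h : Commute (f a) (f x)) :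
    f (adPreimage 𝕜 a x) = 0 := by
  have hlie : f ⁅a, x⁆ = 0 := by
    rw [Ring.lie_def, map_sub, map_mul, map_mul, h.eq, sub_self]
  have hlie' : ∀ y, f y = 0 → f ⁅a, y⁆ = 0 := fun y hy => by
    simp [Ring.lie_def, hy]
  simp [adPreimage, hlie, hlie' _ (hlie' _ hlie)]

end AdCubic

theorem derivation_conj_sub_lie {d : R →+ R} (hd : ∀ x y, d (x * y) = d x * y + x * d y)
    {T U c N : R} (M : R) (hTU : T * U = 1) (hUT : U * T = 1) (hc : d c = 0) (hcN : Commute c N) :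
    d (T * c * U) - ⁅M, T * c * U⁆ =
      (d T - M * T + T * N) * (c * U) - T * c * U * (d T - M * T + T * N) * U := by
  have hd_one : d 1 = 0 := by simpa using hd 1 1
  have hdU : d U = -(U * d T * U) := by
    have h := congrArg (U * ·) (hd T U)
    simp only [hTU, hd_one, mul_zero, mul_add, ← mul_assoc, hUT, one_mul] at h
    exact eq_neg_of_add_eq_zero_right h.symm
  have hUTN : T * c * U * (T * N) * U = T * N * (c * U) := by
    rw [mul_assoc _ U, ← mul_assoc U, hUT, one_mul, mul_assoc T, hcN.eq]
    simp only [mul_assoc]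
  have hUMT : T * c * U * (M * T) * U = T * c * U * M := by
    rw [mul_assoc _ (M * T), mul_assoc M, hTU, mul_one]
  rw [hd, hd, hc, hdU, Ring.lie_def]
  simp only [add_mul, sub_mul, mul_add, mul_sub, hUTN, hUMT]
  noncomm_ring

/-- An additive map applied to the coefficients of a power series. -/
def mapCoeff (d : R →+ R) : R⟦X⟧ →+ R⟦X⟧ where
  toFun F := PowerSeries.mk fun n => d (coeff n F)
  map_zero' := by ext; simp
  map_add' F G := by ext; simp

theorem coeff_mapCoeff (d : R →+ R) (n : ℕ) (F : R⟦X⟧) :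
    coeff n (mapCoeff d F) = d (coeff n F) :=
  coeff_mk n fun n => d (coeff n F)

theorem mapCoeff_mul {d : R →+ R} (hd : ∀ x y, d (x * y) = d x * y + x * d y) (F G : R⟦X⟧) :
    mapCoeff d (F * G) = mapCoeff d F * G + F * mapCoeff d G := by
  ext n
  simp only [coeff_mapCoeff, coeff_mul, map_add, map_sum, hd, Finset.sum_add_distrib]

/-- The derivation `λ⁻¹ D` of `R⟦λ⁻¹⟧` induced by a derivation `D` of `R`. -/
def scaledDeriv (d : R →+ R) : R⟦X⟧ →+ R⟦X⟧ := (AddMonoidHom.mulLeft X).comp (mapCoeff d)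

theorem scaledDeriv_apply (d : R →+ R) (F : R⟦X⟧) : scaledDeriv d F = X * mapCoeff d F := rfl

theorem scaledDeriv_mul {d : R →+ R} (hd : ∀ x y, d (x * y) = d x * y + x * d y) (F G : R⟦X⟧) :
    scaledDeriv d (F * G) = scaledDeriv d F * G + F * scaledDeriv d G := by
  simp only [scaledDeriv_apply, mapCoeff_mul hd, mul_add, ← mul_assoc, (commute_X F).eq]

/-- The error by which `λ⁻¹ H + a` fails to be the gauge transform of `λ⁻¹ Q + a` under `T`. -/
def dressingError (d : R →+ R) (a Q : R) (T H : R⟦X⟧) : R⟦X⟧ :=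
  scaledDeriv d T - (X * C Q + C a) * T + T * (X * H + C a)

theorem mapCoeff_X_pow_mul (d : R →+ R) (n : ℕ) (F : R⟦X⟧) :
    mapCoeff d (X ^ n * F) = X ^ n * mapCoeff d F := by
  ext k
  simp only [coeff_mapCoeff, coeff_X_pow_mul', apply_ite d, map_zero]

theorem mapCoeff_C (d : R →+ R) (t : R) : mapCoeff d (C t) = C (d t) := by
  ext k
  simp only [coeff_mapCoeff, coeff_C, apply_ite d, map_zero]

theorem dressingError_add_add (d : R →+ R) (a Q t h : R) (n : ℕ) (T H : R⟦X⟧) :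
    dressingError d a Q (T + X ^ (n + 1) * C t) (H + X ^ n * C h) =
      dressingError d a Q T H + X ^ (n + 1) * (T * C h - C ⁅a, t⁆ +
        X * (C (d t) - C (Q * t)) + C t * (X * H + X ^ (n + 1) * C h)) := by
  have hpow : X * (H + X ^ n * C h) = X * H + X ^ (n + 1) * C h := by
    rw [mul_add, ← mul_assoc, pow_succ']
  have hleft : ∀ F G : R⟦X⟧, F * (X ^ (n + 1) * G) = X ^ (n + 1) * (F * G) := fun F G => by
    rw [← mul_assoc, (commute_X_pow F (n + 1)).eq, mul_assoc]
  simp only [dressingError, scaledDeriv_apply, hpow, map_add, mapCoeff_X_pow_mul, mapCoeff_C,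
    Ring.lie_def, map_sub, map_mul, add_mul, mul_add, mul_sub, mul_assoc, hleft X, hleft T,
    hleft (C Q), hleft (C a), hleft (C t)]
  abel

theorem map_mapCoeff_of_map_eq_zero (f : R →+* R') {d : R →+ R} (h : ∀ x, f (d x) = 0)
    (F : R⟦X⟧) : map f (mapCoeff d F) = 0 := by
  ext n
  rw [coeff_map, coeff_mapCoeff, h, map_zero]

theorem map_dressingError_of_map_eq_one {f : R →+* R'} {d : R →+ R} (hfd : ∀ x, f (d x) = 0)
    {a Q : R} (hfQ : f Q = 0) {T : R⟦X⟧} (hT : map f T = 1) (H : R⟦X⟧) :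
    map f (dressingError d a Q T H) = X * map f H := by
  simp only [dressingError, scaledDeriv_apply, map_add, map_sub, map_mul,
    map_mapCoeff_of_map_eq_zero f hfd, map_C, map_X, hfQ, hT, map_zero, mul_zero, mul_one,
    one_mul]
  abel

theorem coeff_succ_scaledDeriv_sub_lie (d : R →+ R) (a Q : R) (F : R⟦X⟧) (k : ℕ) :
    coeff (k + 1) (scaledDeriv d F - ⁅X * C Q + C a, F⁆) =
      d (coeff k F) - ⁅Q, coeff k F⁆ - ⁅a, coeff (k + 1) F⁆ := by
  have hright : F * (X * C Q) = X * (F * C Q) := by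
    rw [← mul_assoc, (commute_X F).eq, mul_assoc]
  simp only [Ring.lie_def, scaledDeriv_apply, add_mul, mul_add, hright, mul_assoc X, map_add,
    map_sub, coeff_succ_X_mul, coeff_mapCoeff, coeff_C_mul, coeff_mul_C]
  abel

theorem X_pow_dvd_scaledDeriv_sub_lie {d : R →+ R} (hd : ∀ x y, d (x * y) = d x * y + x * d y)
    {a Q : R} {T U H : R⟦X⟧} (hTU : T * U = 1) (hUT : U * T = 1) (hda : d a = 0)
    (hH : Commute (C a) H) {n : ℕ} (hE : X ^ n ∣ dressingError d a Q T H) :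
    X ^ n ∣ scaledDeriv d (T * C a * U) - ⁅X * C Q + C a, T * C a * U⁆ := by
  have hDa : scaledDeriv d (C a) = 0 := by
    rw [scaledDeriv_apply, mapCoeff_C, hda, map_zero, mul_zero]
  have hcomm : Commute (C a) (X * H + C a) :=
    ((commute_X _).mul_right hH).add_right (Commute.refl _)
  obtain ⟨E, hE⟩ := hE
  rw [derivation_conj_sub_lie (scaledDeriv_mul hd) _ hTU hUT hDa hcomm, ← dressingError, hE,
    ← mul_assoc _ (X ^ n), (commute_X_pow _ _).eq]
  simp only [mul_assoc]
  exact dvd_sub (dvd_mul_right _ _) (dvd_mul_right _ _)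

variable {𝕜 : Type*} [Field 𝕜] [CharZero 𝕜] [Algebra 𝕜 R] [Algebra 𝕜 R']

theorem exists_dressing (f : R →ₐ[𝕜] R') {d : R →+ R} (hfd : ∀ x, f (d x) = 0) {a Q : R}
    (ha : a * a * a = -a) (hfQ : f Q = 0) (N : ℕ) :
    ∃ T H : R⟦X⟧, constantCoeff T = 1 ∧ Commute (C a) H ∧ map (f : R →+* R') T = 1 ∧
      X ^ (N + 1) ∣ dressingError d a Q T H := by
  induction N with
  | zero =>
    refine ⟨1, 0, map_one _, Commute.zero_right _, map_one _, ?_⟩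
    rw [zero_add, pow_one, X_dvd_iff]
    simp [dressingError, scaledDeriv_apply]
  | succ N ih =>
    obtain ⟨T, H, hT, hH, hfT, hE⟩ := ih
    set x := coeff (N + 1) (dressingError d a Q T H) with hx
    have hfx : Commute (f a) (f x) := by
      have hcoeff := congrArg (coeff (N + 1))
        (map_dressingError_of_map_eq_one (f := (f : R →+* R')) (a := a) hfd hfQ hfT H)
      rw [coeff_map, coeff_succ_X_mul, coeff_map] at hcoeff
      change f x = f (coeff N H) at hcoeff
      have haH := congrArg (coeff N) hH.eq
      rw [coeff_C_mul, coeff_mul_C] at haH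
      rw [hcoeff]
      exact Commute.map haH f
    refine ⟨T + X ^ (N + 1) * C (adPreimage 𝕜 a x), H + X ^ N * C (⁅a, adPreimage 𝕜 a x⁆ - x),
      ?_, ?_, ?_, ?_⟩
    · simp [hT]
    · have := (commute_lie_adPreimage_sub (𝕜 := 𝕜) ha x).map (C (R := R))
      exact hH.add_right ((commute_X_pow _ _).mul_right this)
    · simp [hfT, map_adPreimage_of_commute f hfx]
    · rw [dressingError_add_add]
      obtain ⟨E, hE⟩ := hE
      have hxE : x = constantCoeff E := by
        rw [hx, hE, ← coeff_zero_eq_constantCoeff_apply]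
        simpa using coeff_X_pow_mul E (N + 1) 0
      rw [hE, ← mul_add, pow_succ]
      refine mul_dvd_mul_left _ ?_
      rw [X_dvd_iff]
      simp [hT, ← hxE]

theorem exists_lax_recursion (f : R →ₐ[𝕜] R') {d : R →+ R}
    (hd : ∀ x y, d (x * y) = d x * y + x * d y) (hfd : ∀ x, f (d x) = 0) {a Q : R}
    (ha : a * a * a = -a) (hda : d a = 0) (hfQ : f Q = 0) (N : ℕ) :
    ∃ v : ℕ → R, v 0 = a ∧ (∀ k, f (v (k + 1)) = 0) ∧
      ∀ k < N, d (v k) - ⁅Q, v k⁆ = ⁅a, v (k + 1)⁆ := by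
  obtain ⟨T, H, hT, hH, hfT, hE⟩ := exists_dressing f hfd ha hfQ N
  have hTU : T * invOfUnit T 1 = 1 := mul_invOfUnit T 1 hT
  have hUT : invOfUnit T 1 * T = 1 := invOfUnit_mul T 1 hT
  set U := invOfUnit T 1
  have hfU : map (f : R →+* R') U = 1 := by simpa [hfT] using congrArg (map (f : R →+* R')) hTU
  have hfV : map (f : R →+* R') (T * C a * U) = C (f a) := by
    rw [map_mul, map_mul, hfT, hfU, map_C, one_mul, mul_one]
    rfl
  have hdvd := X_pow_dvd_scaledDeriv_sub_lie hd hTU hUT hda hH hE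
  refine ⟨fun k => coeff k (T * C a * U), ?_, fun k => ?_, fun k hk => ?_⟩
  · have hU : constantCoeff U = 1 := by simpa [hT] using congrArg constantCoeff hTU
    simp [hT, hU]
  · have h := congrArg (coeff (k + 1)) hfV
    rwa [coeff_map, coeff_C_of_ne_zero k.succ_ne_zero] at h
  · have h := X_pow_dvd_iff.1 hdvd (k + 1) (Nat.succ_lt_succ hk)
    rwa [coeff_succ_scaledDeriv_sub_lie, sub_eq_zero] at h

end Dressing

theorem IsDiffFun.exists_lax_recursion {M E : Type*} [NormedAddCommGroup M] [NormedSpace ℝ M]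
    [NormedRing E] [NormedAlgebra ℝ E] {Q : (ℕ → M) → E} (hQ : IsDiffFun Q) (hQ0 : Q 0 = 0)
    {a : E} (ha : a * a * a = -a) (N : ℕ) : ∃ v : ℕ → (ℕ → M) → E,
      (∀ k, IsDiffFun (v k)) ∧ (∀ u, v 0 u = a) ∧ (∀ k, v (k + 1) 0 = 0) ∧
        ∀ k < N, ∀ u, _root_.totalDeriv (v k) u - ⁅Q u, v k u⁆ = ⁅a, v (k + 1) u⁆ := by
  obtain ⟨V, hV0, hVzero, hV⟩ := _root_.exists_lax_recursion (diffFunAlgebra.evalZero M E)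
    diffFunAlgebra.D_mul diffFunAlgebra.evalZero_D (a := ⟨fun _ => a, IsDiffFun.const a⟩)
    (Q := ⟨Q, hQ⟩) (Subtype.ext (funext fun _ => ha))
    (Subtype.ext (funext fun u => totalDeriv_const a u)) hQ0 N
  exact ⟨fun k => (V k).1, fun k => (V k).2, congrFun (congrArg Subtype.val hV0), hVzero,
    fun k hk => congrFun (congrArg Subtype.val (hV k hk))⟩

section EquivariantRetraction

variable (K L : Type*) [Field K] [LieRing L] [LieAlgebra K L] [FiniteDimensional K L]
  [LieAlgebra.IsKilling K L]

/-- The retraction of `End L` onto the image of the adjoint representation given by the Killing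
form: `adRetraction K L φ` represents the functional `x ↦ tr (ad x ∘ φ)`. -/
def adRetraction : Module.End K L →ₗ[K] L :=
  (LinearMap.BilinForm.toDual (killingForm K L)
      (LieAlgebra.IsKilling.killingForm_nondegenerate K L)).symm ∘ₗ
    ((LinearMap.mul K (Module.End K L)).flip.compr₂ (LinearMap.trace K L)).compl₂
      (LieAlgebra.ad K L : L →ₗ[K] Module.End K L)

variable {K L}

theorem killingForm_adRetraction (φ : Module.End K L) (x : L) :
    killingForm K L (adRetraction K L φ) x = LinearMap.trace K L (LieAlgebra.ad K L x * φ) :=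
  LinearMap.BilinForm.apply_toDual_symm_apply
    (hB := LieAlgebra.IsKilling.killingForm_nondegenerate K L) _ x

theorem eq_of_killingForm_eq {x y : L} (h : ∀ z, killingForm K L x z = killingForm K L y z) :
    x = y :=
  (LinearMap.BilinForm.toDual _ (LieAlgebra.IsKilling.killingForm_nondegenerate K L)).injective
    (LinearMap.ext h)

theorem adRetraction_ad (x : L) : adRetraction K L (LieAlgebra.ad K L x) = x :=
  eq_of_killingForm_eq fun z => by
    rw [killingForm_adRetraction, LinearMap.trace_mul_comm]
    rfl

theorem adRetraction_lie (x : L) (φ : Module.End K L) :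
    adRetraction K L ⁅LieAlgebra.ad K L x, φ⁆ = ⁅x, adRetraction K L φ⁆ :=
  eq_of_killingForm_eq (K := K) fun z => by
    rw [LieModule.traceForm_apply_lie_apply', killingForm_adRetraction, killingForm_adRetraction,
      ← map_neg, LieHom.map_lie, ← neg_mul, lie_skew, LinearMap.trace_lie_mul_eq]

end EquivariantRetraction

namespace HermitianSymmetric

variable {𝔸 : Type*} [NormedRing 𝔸] [NormedAlgebra ℝ 𝔸] {S : HermitianSymmetric 𝔸}

section LieAlgebra

theorem mem_𝔤_of_mem_𝔥 {X : 𝔸} (hX : X ∈ S.𝔥) : X ∈ S.𝔤 := by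
  have h : X ∈ S.𝔤.toSubmodule := S.sup_eq ▸ Submodule.mem_sup_left hX
  exact h

theorem mem_𝔤_of_mem_𝔪 {X : 𝔸} (hX : X ∈ S.𝔪) : X ∈ S.𝔤 := by
  have h : X ∈ S.𝔤.toSubmodule := S.sup_eq ▸ Submodule.mem_sup_right hX
  exact h

theorem exists_mem_𝔥_add_mem_𝔪 {X : 𝔸} (hX : X ∈ S.𝔤) : ∃ Y ∈ S.𝔥, ∃ Z ∈ S.𝔪, Y + Z = X :=
  Submodule.mem_sup.1 (S.sup_eq.symm ▸ hX : X ∈ S.𝔥 ⊔ S.𝔪)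

theorem lie_A_of_mem_𝔥 {X : 𝔸} (hX : X ∈ S.𝔥) : ⁅S.A, X⁆ = 0 :=
  (S.centralizer_A X (mem_𝔤_of_mem_𝔥 hX)).2 hX

theorem lie_A_mem_𝔪 {X : 𝔸} (hX : X ∈ S.𝔪) : ⁅S.A, X⁆ ∈ S.𝔪 := S.lie_𝔥_𝔪 _ S.A_mem _ hX

theorem lie_𝔪_𝔥 {X Y : 𝔸} (hX : X ∈ S.𝔪) (hY : Y ∈ S.𝔥) : ⁅X, Y⁆ ∈ S.𝔪 := by
  rw [← lie_skew]
  exact S.𝔪.neg_mem (S.lie_𝔥_𝔪 _ hY _ hX)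

theorem lie_lie_A_eq_neg {X Y : 𝔸} (hX : X ∈ S.𝔪) (hY : Y ∈ S.𝔪) :
    ⁅X, ⁅S.A, Y⁆⁆ = -⁅⁅S.A, X⁆, Y⁆ := by
  have h := lie_A_of_mem_𝔥 (S.lie_𝔪_𝔪 X hX Y hY)
  rw [leibniz_lie] at h
  exact eq_neg_of_add_eq_zero_right h

theorem lie_A_lie_A_lie_A {X : 𝔸} (hX : X ∈ S.𝔤) : ⁅S.A, ⁅S.A, ⁅S.A, X⁆⁆⁆ = -⁅S.A, X⁆ := by
  obtain ⟨Y, hY, Z, hZ, rfl⟩ := exists_mem_𝔥_add_mem_𝔪 hX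
  rw [lie_add, lie_A_of_mem_𝔥 hY, zero_add, S.ad_A_sq Z hZ, lie_neg]

end LieAlgebra

section LaxCoefficients

variable (S) in
/-- `v₀, v₁, …` solves, up to order `N`, the recursion for the coefficients of a formal solution
`V = v₀ + λ⁻¹ v₁ + λ⁻² v₂ + ⋯` of `D V = [λ A + u, V]` with `v₀ = A`, all coefficients being
`𝔤`-valued differential functions, and with zero constants of integration. -/
structure IsLaxSequence (N : ℕ) (v : ℕ → S.Jet → 𝔸) : Prop where
  isDiffFun : ∀ k, IsDiffFun (v k)
  mem_𝔤 : ∀ k u, v k u ∈ S.𝔤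
  zero : ∀ u, v 0 u = S.A
  succ_zero : ∀ k, v (k + 1) 0 = 0
  totalDeriv_sub_lie : ∀ k < N, ∀ u,
    totalDeriv (v k) u - ⁅(u 0 : 𝔸), v k u⁆ = ⁅S.A, v (k + 1) u⁆

variable [FiniteDimensional ℝ 𝔸]

variable (S) in
/-- The adjoint representation of `𝔤` on itself, with values in the normed algebra of continuous
linear maps. -/
def adCLM : S.𝔤 →ₗ[ℝ] (S.𝔤 →L[ℝ] S.𝔤) :=
  (Module.End.toContinuousLinearMap S.𝔤).toLinearMap ∘ₗ (LieAlgebra.ad ℝ S.𝔤).toLinearMap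

variable (S) in
theorem adCLM_A_cube : S.adCLM ⟨S.A, S.A_mem_𝔤⟩ * S.adCLM ⟨S.A, S.A_mem_𝔤⟩ *
    S.adCLM ⟨S.A, S.A_mem_𝔤⟩ = -S.adCLM ⟨S.A, S.A_mem_𝔤⟩ := by
  ext X
  exact lie_A_lie_A_lie_A X.2

variable (S) in
theorem exists_adCLM_retraction : ∃ π : (S.𝔤 →L[ℝ] S.𝔤) →L[ℝ] 𝔸, (∀ φ, π φ ∈ S.𝔤) ∧
    (∀ X, π (S.adCLM X) = X) ∧ ∀ X φ, π ⁅S.adCLM X, φ⁆ = ⁅(X : 𝔸), π φ⁆ := by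
  have := S.isSemisimple
  refine ⟨LinearMap.toContinuousLinearMap (S.𝔤.toSubmodule.subtype ∘ₗ adRetraction ℝ S.𝔤 ∘ₗ
    (Module.End.toContinuousLinearMap S.𝔤).symm.toLinearMap), fun φ => Subtype.prop _,
    fun X => congrArg Subtype.val (adRetraction_ad X),
    fun X φ => congrArg Subtype.val (adRetraction_lie X _)⟩

variable (S) in
theorem exists_isLaxSequence (N : ℕ) : ∃ v, S.IsLaxSequence N v := by
  obtain ⟨π, hπ_mem, hπ_ad, hπ_lie⟩ := S.exists_adCLM_retraction
  let θ : S.𝔪 →ₗ[ℝ] (S.𝔤 →L[ℝ] S.𝔤) :=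
    S.adCLM ∘ₗ Submodule.inclusion fun X hX => mem_𝔤_of_mem_𝔪 hX
  have hθ : IsDiffFun fun u : S.Jet => θ (u 0) :=
    (IsDiffFun.eval 0).clm (W₁ := S.𝔤 →L[ℝ] S.𝔤) (LinearMap.toContinuousLinearMap θ)
  obtain ⟨V, hVdiff, hV0, hVzero, hV⟩ := IsDiffFun.exists_lax_recursion (E := S.𝔤 →L[ℝ] S.𝔤) hθ
    (map_zero θ) S.adCLM_A_cube N
  refine ⟨fun k u => π (V k u), fun k => (hVdiff k).clm π, fun k u => hπ_mem _, fun u => ?_,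
    fun k => ?_, fun k hk u => ?_⟩
  · exact (congrArg π (hV0 u)).trans (hπ_ad _)
  · exact (congrArg π (hVzero k)).trans (map_zero π)
  · calc totalDeriv (fun u => π (V k u)) u - ⁅(u 0 : 𝔸), π (V k u)⁆
        = π (totalDeriv (V k) u) - π ⁅θ (u 0), V k u⁆ :=
          congrArg₂ _ (totalDeriv_clm (hVdiff k) π u) (hπ_lie ⟨u 0, _⟩ _).symm
      _ = π ⁅S.adCLM ⟨S.A, S.A_mem_𝔤⟩, V (k + 1) u⁆ := by rw [← map_sub, hV k hk u]
      _ = ⁅S.A, π (V (k + 1) u)⁆ := hπ_lie _ _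

end LaxCoefficients

section Coefficients

theorem isDiffFun_coe_eval (k : ℕ) : IsDiffFun (fun u : S.Jet => (u k : 𝔸)) :=
  (IsDiffFun.eval k).clm S.𝔪.subtypeL

theorem totalDeriv_coe_eval (k : ℕ) (u : S.Jet) :
    totalDeriv (fun u : S.Jet => (u k : 𝔸)) u = (u (k + 1) : 𝔸) :=
  (totalDeriv_clm (IsDiffFun.eval k) S.𝔪.subtypeL u).trans
    (congrArg Subtype.val (totalDeriv_eval k u))

theorem lie_A_mem_𝔪_of_mem_𝔤 {X : 𝔸} (hX : X ∈ S.𝔤) : ⁅S.A, X⁆ ∈ S.𝔪 := by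
  obtain ⟨Y, hY, Z, hZ, rfl⟩ := exists_mem_𝔥_add_mem_𝔪 hX
  rw [lie_add, lie_A_of_mem_𝔥 hY, zero_add]
  exact lie_A_mem_𝔪 hZ

variable (S) in
/-- The projection of `𝔤` onto `𝔪` along `𝔥`, written as `-ad(A)²`. -/
def projM (X : 𝔸) : 𝔸 := -⁅S.A, ⁅S.A, X⁆⁆

variable (S) in
/-- The projection of `𝔤` onto `𝔥` along `𝔪`, written as `1 + ad(A)²`. -/
def projH (X : 𝔸) : 𝔸 := X + ⁅S.A, ⁅S.A, X⁆⁆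

theorem projM_mem {X : 𝔸} (hX : X ∈ S.𝔤) : S.projM X ∈ S.𝔪 :=
  S.𝔪.neg_mem (lie_A_mem_𝔪 (lie_A_mem_𝔪_of_mem_𝔤 hX))

theorem projH_mem {X : 𝔸} (hX : X ∈ S.𝔤) : S.projH X ∈ S.𝔥 := by
  obtain ⟨Y, hY, Z, hZ, rfl⟩ := exists_mem_𝔥_add_mem_𝔪 hX
  rwa [projH, lie_add, lie_A_of_mem_𝔥 hY, zero_add, S.ad_A_sq Z hZ, add_neg_cancel_right]

theorem isDiffFun_projM {F : S.Jet → 𝔸} (hF : IsDiffFun F) :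
    IsDiffFun fun u => S.projM (F u) :=
  ((IsDiffFun.const S.A).lie ((IsDiffFun.const S.A).lie hF)).neg

theorem isDiffFun_projH {F : S.Jet → 𝔸} (hF : IsDiffFun F) :
    IsDiffFun fun u => S.projH (F u) :=
  hF.add ((IsDiffFun.const S.A).lie ((IsDiffFun.const S.A).lie hF))

theorem eq_zero_and_eq_of_add_eq {X Y Z : 𝔸} (hX : X ∈ S.𝔥) (hY : Y ∈ S.𝔪) (hZ : Z ∈ S.𝔪)
    (h : X + Y = Z) : X = 0 ∧ Y = Z := by
  have hX0 : X = 0 := Submodule.disjoint_def.1 S.disjoint X hX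
    (eq_sub_of_add_eq h ▸ S.𝔪.sub_mem hZ hY)
  rw [hX0, zero_add] at h
  exact ⟨hX0, h⟩

variable (S) in
/-- `(ℛ*)ᵏ(u)`. This is the `𝔪`-part of the coefficient of `λ⁻ᵏ⁻¹` in the formal solution
`A + O(λ⁻¹)` of `D V = [λ A + u, V]`. -/
def coeffM (k : ℕ) : S.Jet → 𝔸 := S.RopAdj^[k] S.var

variable (S) in
/-- `D⁻¹[u, (ℛ*)ᵏ(u)]`. This is the `𝔥`-part of the coefficient of `λ⁻ᵏ⁻¹` in the formal solution
`A + O(λ⁻¹)` of `D V = [λ A + u, V]`. -/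
def coeffH (k : ℕ) : S.Jet → 𝔸 := S.Dinv (S.adVar (S.coeffM k))

theorem coeffM_succ (k : ℕ) : S.coeffM (k + 1) = S.Jinv (S.Hop (S.coeffM k)) :=
  Function.iterate_succ_apply' _ _ _

theorem hop_coeffM (k : ℕ) (u : S.Jet) :
    S.Hop (S.coeffM k) u = totalDeriv (S.coeffM k) u - ⁅(u 0 : 𝔸), S.coeffH k u⁆ := rfl

theorem isPrimitive_of_totalDeriv_eq {p f : S.Jet → 𝔸} (hp : IsDiffFun p)
    (h : ∀ u, totalDeriv p u = f u) (h0 : p 0 = 0) : S.IsPrimitive p f :=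
  ⟨hp, funext h, h0⟩

variable [FiniteDimensional ℝ 𝔸]

theorem IsPrimitive.unique {p p' f : S.Jet → 𝔸} (h : S.IsPrimitive p f)
    (h' : S.IsPrimitive p' f) : p = p' :=
  IsDiffFun.eq_of_totalDeriv_eq h.1 h'.1 (h.2.1.trans h'.2.1.symm) (h.2.2.trans h'.2.2.symm)

theorem IsPrimitive.dinv_eq {p f : S.Jet → 𝔸} (h : S.IsPrimitive p f) : S.Dinv f = p := by
  have hex : ∃ p, S.IsPrimitive p f := ⟨p, h⟩
  rw [Dinv, dif_pos hex]
  exact hex.choose_spec.unique h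

namespace IsLaxSequence

variable {N k : ℕ} {v : ℕ → S.Jet → 𝔸}

theorem totalDeriv_projH_and_projM (hv : S.IsLaxSequence N v) (hk : k + 1 < N) (u : S.Jet) :
    totalDeriv (fun u => S.projH (v (k + 1) u)) u - ⁅(u 0 : 𝔸), S.projM (v (k + 1) u)⁆ = 0 ∧
      totalDeriv (fun u => S.projM (v (k + 1) u)) u - ⁅(u 0 : 𝔸), S.projH (v (k + 1) u)⁆ =
        ⁅S.A, v (k + 2) u⁆ := by
  have hM := fun u => projM_mem (hv.mem_𝔤 (k + 1) u)
  have hH := fun u => projH_mem (hv.mem_𝔤 (k + 1) u)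
  have hsum : (fun u => S.projH (v (k + 1) u) + S.projM (v (k + 1) u)) = v (k + 1) :=
    funext fun u => add_neg_cancel_right _ _
  have hsplit : totalDeriv (fun u => S.projH (v (k + 1) u)) u +
      totalDeriv (fun u => S.projM (v (k + 1) u)) u -
      (⁅(u 0 : 𝔸), S.projH (v (k + 1) u)⁆ + ⁅(u 0 : 𝔸), S.projM (v (k + 1) u)⁆) =
        ⁅S.A, v (k + 2) u⁆ := by
    rw [← totalDeriv_add (isDiffFun_projH (hv.isDiffFun _)) (isDiffFun_projM (hv.isDiffFun _)),
      ← lie_add, congrFun hsum u, hsum, hv.totalDeriv_sub_lie (k + 1) hk u]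
  refine eq_zero_and_eq_of_add_eq
    (S.𝔥.sub_mem (totalDeriv_mem hH u) (S.lie_𝔪_𝔪 _ (u 0).2 _ (hM u)))
    (S.𝔪.sub_mem (totalDeriv_mem hM u) (lie_𝔪_𝔥 (u 0).2 (hH u)))
    (lie_A_mem_𝔪_of_mem_𝔤 (hv.mem_𝔤 _ u)) ?_
  rw [← hsplit]
  abel

theorem isPrimitive (hv : S.IsLaxSequence N v) (hk : k + 1 < N) :
    S.IsPrimitive (fun u => S.projH (v (k + 1) u)) (S.adVar fun u => S.projM (v (k + 1) u)) :=
  isPrimitive_of_totalDeriv_eq (isDiffFun_projH (hv.isDiffFun _))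
    (fun u => sub_eq_zero.1 (hv.totalDeriv_projH_and_projM hk u).1)
    (by simp [projH, hv.succ_zero])

theorem coeffM_eq (hv : S.IsLaxSequence N v) (hk : k < N) :
    S.coeffM k = fun u => S.projM (v (k + 1) u) := by
  induction k with
  | zero =>
    funext u
    have hA : totalDeriv (v 0) u = 0 := by
      rw [show v 0 = fun _ => S.A from funext hv.zero, totalDeriv_const]
    rw [projM, ← hv.totalDeriv_sub_lie 0 hk u, hA, hv.zero, zero_sub, lie_skew S.A (u 0 : 𝔸),
      S.ad_A_sq _ (u 0).2, neg_neg]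
    rfl
  | succ k ih =>
    funext u
    rw [coeffM_succ, Jinv, hop_coeffM, coeffH, ih (by omega), (hv.isPrimitive hk).dinv_eq,
      (hv.totalDeriv_projH_and_projM hk u).2, projM]

theorem coeffH_eq (hv : S.IsLaxSequence N v) (hk : k + 1 < N) :
    S.coeffH k = fun u => S.projH (v (k + 1) u) := by
  rw [coeffH, hv.coeffM_eq (by omega), (hv.isPrimitive hk).dinv_eq]

end IsLaxSequence

theorem isDiffFun_coeffM (k : ℕ) : IsDiffFun (S.coeffM k) := by
  obtain ⟨v, hv⟩ := S.exists_isLaxSequence (k + 1)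
  rw [hv.coeffM_eq k.lt_succ_self]
  exact isDiffFun_projM (hv.isDiffFun _)

theorem coeffM_mem (k : ℕ) (u : S.Jet) : S.coeffM k u ∈ S.𝔪 := by
  obtain ⟨v, hv⟩ := S.exists_isLaxSequence (k + 1)
  rw [hv.coeffM_eq k.lt_succ_self]
  exact projM_mem (hv.mem_𝔤 _ u)

theorem isPrimitive_coeffH (k : ℕ) : S.IsPrimitive (S.coeffH k) (S.adVar (S.coeffM k)) := by
  obtain ⟨v, hv⟩ := S.exists_isLaxSequence (k + 2)
  rw [hv.coeffH_eq (k + 1).lt_succ_self, hv.coeffM_eq (by omega)]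
  exact hv.isPrimitive (k + 1).lt_succ_self

theorem isDiffFun_coeffH (k : ℕ) : IsDiffFun (S.coeffH k) := (isPrimitive_coeffH k).1

theorem totalDeriv_coeffH (k : ℕ) (u : S.Jet) :
    totalDeriv (S.coeffH k) u = ⁅(u 0 : 𝔸), S.coeffM k u⁆ :=
  congrFun (isPrimitive_coeffH k).2.1 u

theorem coeffH_mem (k : ℕ) (u : S.Jet) : S.coeffH k u ∈ S.𝔥 := by
  obtain ⟨v, hv⟩ := S.exists_isLaxSequence (k + 2)
  rw [hv.coeffH_eq (k + 1).lt_succ_self]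
  exact projH_mem (hv.mem_𝔤 _ u)

theorem lie_A_coeffM_succ (k : ℕ) (u : S.Jet) :
    ⁅S.A, S.coeffM (k + 1) u⁆ = S.Hop (S.coeffM k) u := by
  have hmem : S.Hop (S.coeffM k) u ∈ S.𝔪 := S.𝔪.sub_mem (totalDeriv_mem (coeffM_mem k) u)
    (lie_𝔪_𝔥 (u 0).2 (coeffH_mem k u))
  rw [coeffM_succ, Jinv, lie_neg, S.ad_A_sq _ hmem, neg_neg]

end Coefficients

end HermitianSymmetric

theorem iteratedDeriv_clm_comp {V W : Type*} [NormedAddCommGroup V] [NormedSpace ℝ V]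
    [NormedAddCommGroup W] [NormedSpace ℝ W] (L : V →L[ℝ] W) {f : ℝ → V} (hf : ContDiff ℝ ∞ f)
    (k : ℕ) (x : ℝ) : iteratedDeriv k (fun y => L (f y)) x = L (iteratedDeriv k f x) := by
  induction k generalizing x with
  | zero => simp only [iteratedDeriv_zero]
  | succ k ih =>
    rw [iteratedDeriv_succ, funext ih, iteratedDeriv_succ]
    exact (L.hasFDerivAt.comp_hasDerivAt x ((hf.differentiable_iteratedDeriv k
      (by exact_mod_cast ENat.natCast_lt_top _)) x).hasDerivAt).deriv

namespace HermitianSymmetric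

variable {𝔸 : Type*} [NormedRing 𝔸] [NormedAlgebra ℝ 𝔸] {S : HermitianSymmetric 𝔸}

section Hierarchy

variable [FiniteDimensional ℝ 𝔸]

theorem jinv_J_coeffM (n : ℕ) : S.Jinv (S.J (S.coeffM n)) = S.coeffM n := funext fun u => by
  rw [Jinv, J, S.ad_A_sq _ (coeffM_mem n u), neg_neg]

theorem hier_eq_J_coeffM (n : ℕ) : S.hier n = S.J (S.coeffM n) := by
  induction n with
  | zero => rfl
  | succ n ih =>
    have hsucc : S.hier (n + 1) = S.Rop (S.hier n) := Function.iterate_succ_apply' _ _ _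
    rw [hsucc, ih, Rop, jinv_J_coeffM]
    exact funext fun u => (lie_A_coeffM_succ n u).symm

theorem hier_apply (n : ℕ) (u : S.Jet) : S.hier n u = ⁅S.A, S.coeffM n u⁆ :=
  congrFun (hier_eq_J_coeffM n) u

theorem hier_succ (n : ℕ) : S.hier (n + 1) = S.Hop (S.coeffM n) := by
  rw [hier_eq_J_coeffM]
  exact funext fun u => lie_A_coeffM_succ n u

theorem jinv_hier (n : ℕ) : S.Jinv (S.hier n) = S.coeffM n := by
  rw [hier_eq_J_coeffM, jinv_J_coeffM]

theorem isDiffFun_hier (n : ℕ) : IsDiffFun (S.hier n) := by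
  rw [hier_eq_J_coeffM]
  exact (IsDiffFun.const S.A).lie (isDiffFun_coeffM n)

theorem hier_mem (n : ℕ) (u : S.Jet) : S.hier n u ∈ S.𝔪 := by
  rw [hier_apply]
  exact lie_A_mem_𝔪 (coeffM_mem n u)

theorem existsUnique_isPrimitive_adVar_jinv_hier (n : ℕ) :
    ∃! p, S.IsPrimitive p (S.adVar (S.Jinv (S.hier n))) := by
  rw [jinv_hier]
  exact ⟨S.coeffH n, isPrimitive_coeffH n, fun p hp => hp.unique (isPrimitive_coeffH n)⟩

end Hierarchy

section LaxPair

theorem laxV_zero (l : ℝ) : S.laxV 0 l = fun _ => S.A := by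
  funext u
  simp [laxV]

theorem laxV_succ (n : ℕ) (l : ℝ) :
    S.laxV (n + 1) l = fun u => l • S.laxV n l u + (S.coeffM n u + S.coeffH n u) := by
  have hM : ∀ k, S.laxVm (n + 1) (k + 1) = S.laxVm n k := fun k => by
    rw [laxVm, laxVm, show n + 1 - 1 - (k + 1) = n - 1 - k by omega]
  have hH : ∀ k, S.laxVh (n + 1) (k + 1) = S.laxVh n k := fun k => by rw [laxVh, laxVh, hM]
  funext u
  rw [laxV, Finset.sum_range_succ', pow_zero, one_smul, ← add_assoc]
  congr 1
  simp only [laxV, smul_add, Finset.smul_sum, smul_smul, pow_succ', hM, hH]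

variable [FiniteDimensional ℝ 𝔸]

theorem isDiffFun_laxV (n : ℕ) (l : ℝ) : IsDiffFun (S.laxV n l) := by
  induction n with
  | zero =>
    rw [laxV_zero]
    exact IsDiffFun.const S.A
  | succ n ih =>
    rw [laxV_succ]
    exact (ih.const_smul l).add ((isDiffFun_coeffM n).add (isDiffFun_coeffH n))

theorem totalDeriv_laxV_sub_lie (n : ℕ) (l : ℝ) (u : S.Jet) :
    totalDeriv (S.laxV n l) u - ⁅S.laxU l u, S.laxV n l u⁆ = S.hier n u := by
  induction n with
  | zero =>
    rw [laxV_zero, totalDeriv_const, hier_apply, zero_sub, lie_skew, laxU, lie_add, lie_smul,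
      lie_self, smul_zero, zero_add]
    rfl
  | succ n ih =>
    have hM := isDiffFun_coeffM (S := S) n
    have hH := isDiffFun_coeffH (S := S) n
    have hlie : ⁅S.laxU l u, S.coeffM n u + S.coeffH n u⁆ = l • ⁅S.A, S.coeffM n u⁆ +
        ⁅(u 0 : 𝔸), S.coeffM n u⁆ + ⁅(u 0 : 𝔸), S.coeffH n u⁆ := by
      rw [laxU, add_lie, smul_lie, lie_add, lie_add, lie_A_of_mem_𝔥 (coeffH_mem n u), add_zero,
        add_assoc]
    rw [laxV_succ, totalDeriv_add ((isDiffFun_laxV n l).const_smul l) (hM.add hH),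
      totalDeriv_const_smul (isDiffFun_laxV n l), totalDeriv_add hM hH, totalDeriv_coeffH,
      lie_add, lie_smul, hlie, ← hier_apply, ← ih, hier_succ, hop_coeffM, smul_sub]
    abel

end LaxPair

section SmoothOn

variable {I : Set ℝ} {Q : ℝ → ℝ → S.𝔪}

theorem jet_zero (f : ℝ → S.𝔪) (x : ℝ) : S.jet f x 0 = f x :=
  congrFun iteratedDeriv_zero x

theorem SmoothOn.contDiff_space (h : S.SmoothOn I Q) {t : ℝ} (ht : t ∈ I) :
    ContDiff ℝ ∞ (fun y => Q y t) :=
  contDiffOn_univ.1 (h.comp (f := fun y : ℝ => (y, t))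
    (contDiff_id.prodMk contDiff_const).contDiffOn fun _ _ => ⟨trivial, ht⟩)

theorem SmoothOn.contDiffOn_time (h : S.SmoothOn I Q) (s : ℝ) :
    ContDiffOn ℝ ∞ (fun τ => Q s τ) I :=
  h.comp (f := fun τ : ℝ => (s, τ)) (contDiff_const.prodMk contDiff_id).contDiffOn
    fun _ hτ => ⟨trivial, hτ⟩

theorem SmoothOn.differentiableAt_time (h : S.SmoothOn I Q) (hI : IsOpen I) {t : ℝ}
    (ht : t ∈ I) (s : ℝ) : DifferentiableAt ℝ (fun τ => (Q s τ : 𝔸)) t :=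
  S.𝔪.subtypeL.differentiableAt.comp t
    (((h.contDiffOn_time s).differentiableOn (by simp)).differentiableAt (hI.mem_nhds ht))

theorem hasDerivAt_jet_comp {F : S.Jet → 𝔸} (hF : IsDiffFun F) {f : ℝ → S.𝔪}
    (hf : ContDiff ℝ ∞ f) (x : ℝ) :
    HasDerivAt (fun y => F (S.jet f y)) (totalDeriv F (S.jet f x)) x :=
  hF.hasDerivAt_jet hf x

theorem iteratedDeriv_coe {f : ℝ → S.𝔪} (hf : ContDiff ℝ ∞ f) (k : ℕ) (x : ℝ) :
    iteratedDeriv k (fun y => (f y : 𝔸)) x = (S.jet f x k : 𝔸) :=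
  iteratedDeriv_clm_comp S.𝔪.subtypeL hf k x

end SmoothOn

section ZeroCurvature

variable [FiniteDimensional ℝ 𝔸] {n : ℕ} {I : Set ℝ} {Q : ℝ → ℝ → S.𝔪}

theorem SmoothOn.curvature_eq (h : S.SmoothOn I Q) (hI : IsOpen I) (s : ℝ) {t : ℝ} (ht : t ∈ I)
    (l : ℝ) :
    deriv (fun τ => S.laxU l (S.jet (fun y => Q y τ) s)) t
        - deriv (fun σ => S.laxV n l (S.jet (fun y => Q y t) σ)) s
        + ⁅S.laxU l (S.jet (fun y => Q y t) s), S.laxV n l (S.jet (fun y => Q y t) s)⁆ =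
      deriv (fun τ => (Q s τ : 𝔸)) t - S.hier n (S.jet (fun y => Q y t) s) := by
  have hU : deriv (fun τ => S.laxU l (S.jet (fun y => Q y τ) s)) t =
      deriv (fun τ => (Q s τ : 𝔸)) t := by
    simp only [laxU, jet_zero]
    exact ((h.differentiableAt_time hI ht s).hasDerivAt.const_add (l • S.A)).deriv
  rw [hU, (hasDerivAt_jet_comp (isDiffFun_laxV n l) (h.contDiff_space ht) s).deriv,
    ← totalDeriv_laxV_sub_lie n l]
  abel

theorem isospectralFlow_iff_smoothOn_and_zeroCurvature (hI : IsOpen I) :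
    S.IsospectralFlow n I Q ↔ S.SmoothOn I Q ∧ S.ZeroCurvature n I Q := by
  refine and_congr_right fun h => forall₃_congr fun s t ht => ?_
  simp only [h.curvature_eq hI s ht, sub_eq_zero]
  exact ⟨fun hflow _ => hflow, fun hcurv => hcurv 0⟩

end ZeroCurvature

section Scaling

/-- The action on jets of the substitution of `u ↦ c u(r x)`. -/
def scale (c r : ℝ) (u : S.Jet) : S.Jet := fun k => (c * r ^ k) • u k

variable {c r : ℝ}

theorem scale_zero : scale c r (0 : S.Jet) = 0 := funext fun _ => smul_zero _

theorem coe_scale_eval_zero (u : S.Jet) : (scale c r u 0 : 𝔸) = c • (u 0 : 𝔸) := by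
  simp [scale]

theorem totalDeriv_scale {F : S.Jet → 𝔸} (hF : IsDiffFun F) {b : ℝ}
    (h : ∀ u, F (scale c r u) = b • F u) (u : S.Jet) :
    totalDeriv F (scale c r u) = (r * b) • totalDeriv F u := by
  have hscale : (fun v : S.Jet => F fun k => (c * r ^ k) • v k) = fun v => b • F v := funext h
  rw [mul_smul, ← totalDeriv_const_smul hF, ← hscale]
  exact totalDeriv_smul_pow F c r u

variable [FiniteDimensional ℝ 𝔸]

theorem coeffH_scale_of_coeffM_scale (hc : c ^ 2 = r ^ 2) (hr : r ≠ 0) {k : ℕ}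
    (hM : ∀ u : S.Jet, S.coeffM k (scale c r u) = (c * r ^ k) • S.coeffM k u) (u : S.Jet) :
    S.coeffH k (scale c r u) = r ^ (k + 1) • S.coeffH k u := by
  have hH := isDiffFun_coeffH (S := S) k
  refine congrFun (IsDiffFun.eq_of_totalDeriv_eq (hH.comp_smul _) (hH.const_smul (r ^ (k + 1)))
    (funext fun u => smul_right_injective 𝔸 hr ?_) ?_) u
  · calc r • totalDeriv (fun u => S.coeffH k fun k => (c * r ^ k) • u k) u
        = totalDeriv (S.coeffH k) (scale c r u) := (totalDeriv_smul_pow _ c r u).symm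
      _ = (c ^ 2 * r ^ k) • ⁅(u 0 : 𝔸), S.coeffM k u⁆ := by
        rw [totalDeriv_coeffH, hM, coe_scale_eval_zero, smul_lie, lie_smul, smul_smul]
        ring_nf
      _ = r • totalDeriv (fun u => r ^ (k + 1) • S.coeffH k u) u := by
        rw [totalDeriv_const_smul hH, totalDeriv_coeffH, smul_smul, hc]
        ring_nf
  · change S.coeffH k (scale c r 0) = _
    rw [scale_zero, (isPrimitive_coeffH k).2.2, smul_zero]

theorem coeffM_scale (hc : c ^ 2 = r ^ 2) (hr : r ≠ 0) (k : ℕ) (u : S.Jet) :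
    S.coeffM k (scale c r u) = (c * r ^ k) • S.coeffM k u := by
  induction k generalizing u with
  | zero =>
    rw [pow_zero, mul_one]
    exact coe_scale_eval_zero u
  | succ k ih =>
    rw [coeffM_succ, Jinv, Jinv, hop_coeffM, hop_coeffM, totalDeriv_scale (isDiffFun_coeffM k) ih,
      coeffH_scale_of_coeffM_scale hc hr ih, coe_scale_eval_zero, smul_lie, lie_smul, smul_smul,
      show r * (c * r ^ k) = c * r ^ (k + 1) by ring, ← smul_sub, lie_smul, smul_neg]

theorem coeffH_scale (hc : c ^ 2 = r ^ 2) (hr : r ≠ 0) (k : ℕ) (u : S.Jet) :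
    S.coeffH k (scale c r u) = r ^ (k + 1) • S.coeffH k u :=
  coeffH_scale_of_coeffM_scale hc hr (coeffM_scale hc hr k) u

theorem hier_scale (hc : c ^ 2 = r ^ 2) (hr : r ≠ 0) (n : ℕ) (u : S.Jet) :
    S.hier n (scale c r u) = (c * r ^ n) • S.hier n u := by
  rw [hier_apply, coeffM_scale hc hr, lie_smul, hier_apply]

end Scaling

section ExplicitFlows

variable [FiniteDimensional ℝ 𝔸]

theorem coeffH_zero (u : S.Jet) : S.coeffH 0 u = 0 := by
  have hprim : S.IsPrimitive 0 (S.adVar (S.coeffM 0)) := by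
    refine isPrimitive_of_totalDeriv_eq (IsDiffFun.const 0) (fun u => ?_) rfl
    exact (totalDeriv_const (0 : 𝔸) u).trans (lie_self (u 0 : 𝔸)).symm
  exact congrFun hprim.dinv_eq u

theorem coeffM_one (u : S.Jet) : S.coeffM 1 u = -⁅S.A, (u 1 : 𝔸)⁆ := by
  rw [coeffM_succ, Jinv, hop_coeffM, coeffH_zero, lie_zero, sub_zero]
  exact congrArg (fun X => -⁅S.A, X⁆) (totalDeriv_coe_eval 0 u)

theorem coeffH_one (u : S.Jet) :
    S.coeffH 1 u = -((1 / 2 : ℝ) • ⁅(u 0 : 𝔸), ⁅S.A, (u 0 : 𝔸)⁆⁆) := by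
  have hu := isDiffFun_coe_eval (S := S) 0
  have hAu := (IsDiffFun.const (M := S.𝔪) S.A).lie hu
  have hd := (hu.lie hAu).const_smul (1 / 2 : ℝ)
  have hprim : S.IsPrimitive (fun u => -((1 / 2 : ℝ) • ⁅(u 0 : 𝔸), ⁅S.A, (u 0 : 𝔸)⁆⁆))
      (S.adVar (S.coeffM 1)) := by
    refine isPrimitive_of_totalDeriv_eq hd.neg (fun u => ?_) (by simp)
    have hsymm : ⁅(u 1 : 𝔸), ⁅S.A, (u 0 : 𝔸)⁆⁆ = ⁅(u 0 : 𝔸), ⁅S.A, (u 1 : 𝔸)⁆⁆ := by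
      rw [lie_lie_A_eq_neg (u 1).2 (u 0).2, lie_skew]
    rw [totalDeriv_neg, totalDeriv_const_smul (hu.lie hAu), totalDeriv_lie hu hAu,
      totalDeriv_lie (IsDiffFun.const S.A) hu, totalDeriv_coe_eval, totalDeriv_const, zero_lie,
      zero_add, zero_add, hsymm, adVar, coeffM_one, lie_neg]
    module
  exact congrFun hprim.dinv_eq u

theorem totalDeriv_coeffM_one (u : S.Jet) :
    totalDeriv (S.coeffM 1) u = -⁅S.A, (u 2 : 𝔸)⁆ := by
  rw [funext coeffM_one, totalDeriv_neg, totalDeriv_lie (IsDiffFun.const S.A)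
    (isDiffFun_coe_eval 1), totalDeriv_coe_eval, totalDeriv_const, zero_lie, zero_add]

theorem hier_two (u : S.Jet) : S.hier 2 u =
    -⁅S.A, (u 2 : 𝔸)⁆ + (1 / 2 : ℝ) • ⁅(u 0 : 𝔸), ⁅(u 0 : 𝔸), ⁅S.A, (u 0 : 𝔸)⁆⁆⁆ := by
  rw [hier_succ, hop_coeffM, totalDeriv_coeffM_one, coeffH_one, lie_neg, lie_smul, sub_neg_eq_add]

variable (S) in
/-- The cubic expression `[J u, [J u, u]]` in the mKdV system. -/
def cubicTerm (u : S.Jet) : 𝔸 := ⁅⁅S.A, (u 0 : 𝔸)⁆, ⁅⁅S.A, (u 0 : 𝔸)⁆, (u 0 : 𝔸)⁆⁆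

omit [FiniteDimensional ℝ 𝔸] in
theorem isDiffFun_cubicTerm : IsDiffFun S.cubicTerm :=
  have hAu := (IsDiffFun.const (M := S.𝔪) S.A).lie (isDiffFun_coe_eval 0)
  hAu.lie (hAu.lie (isDiffFun_coe_eval 0))

theorem coeffM_two (u : S.Jet) :
    S.coeffM 2 u = -(u 2 : 𝔸) + (1 / 2 : ℝ) • S.cubicTerm u := by
  have h0 : ⁅S.A, ⁅(u 0 : 𝔸), ⁅S.A, (u 0 : 𝔸)⁆⁆⁆ = 0 :=
    lie_A_of_mem_𝔥 (S.lie_𝔪_𝔪 _ (u 0).2 _ (lie_A_mem_𝔪 (u 0).2))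
  rw [← jinv_hier, Jinv, hier_two, lie_add, lie_neg, lie_smul, S.ad_A_sq _ (u 2).2,
    leibniz_lie S.A (u 0 : 𝔸), h0, lie_zero, add_zero, ← lie_skew (u 0 : 𝔸) ⁅S.A, (u 0 : 𝔸)⁆,
    lie_neg, cubicTerm]
  module

omit [FiniteDimensional ℝ 𝔸] in
theorem lie_cubicTerm (u : S.Jet) : ⁅(u 0 : 𝔸), S.cubicTerm u⁆ = 0 := by
  rw [cubicTerm]
  obtain ⟨X, hX⟩ := u 0
  set K := ⁅⁅S.A, X⁆, X⁆ with hK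
  have hK𝔥 : K ∈ S.𝔥 := S.lie_𝔪_𝔪 _ (lie_A_mem_𝔪 hX) _ hX
  have hcomm : ⁅X, ⁅⁅S.A, X⁆, K⁆⁆ = ⁅⁅S.A, X⁆, ⁅X, K⁆⁆ := by
    rw [leibniz_lie, ← lie_skew X, ← hK, neg_lie, lie_self, neg_zero, zero_add]
  have hanti : ⁅X, ⁅⁅S.A, X⁆, K⁆⁆ = -⁅⁅S.A, X⁆, ⁅X, K⁆⁆ := by
    rw [← lie_lie_A_eq_neg hX (lie_𝔪_𝔥 hX hK𝔥), leibniz_lie S.A X, lie_A_of_mem_𝔥 hK𝔥, lie_zero,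
      add_zero]
  have : IsAddTorsionFree 𝔸 := .of_isTorsionFree ℝ 𝔸
  exact self_eq_neg.1 (hanti.trans (congrArg Neg.neg hcomm.symm))

theorem coeffH_two (u : S.Jet) : S.coeffH 2 u = -⁅(u 0 : 𝔸), (u 1 : 𝔸)⁆ := by
  have h0 := isDiffFun_coe_eval (S := S) 0
  have h1 := isDiffFun_coe_eval (S := S) 1
  have hprim : S.IsPrimitive (fun u => -⁅(u 0 : 𝔸), (u 1 : 𝔸)⁆) (S.adVar (S.coeffM 2)) := by
    refine isPrimitive_of_totalDeriv_eq (h0.lie h1).neg (fun u => ?_) (by simp)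
    rw [totalDeriv_neg, totalDeriv_lie h0 h1, totalDeriv_coe_eval, totalDeriv_coe_eval, lie_self,
      zero_add, adVar, coeffM_two, lie_add, lie_smul, lie_cubicTerm, smul_zero, add_zero, lie_neg]
  exact congrFun hprim.dinv_eq u

theorem hier_three (u : S.Jet) : S.hier 3 u =
    -(u 3 : 𝔸) + ⁅(u 0 : 𝔸), ⁅(u 0 : 𝔸), (u 1 : 𝔸)⁆⁆ +
      (1 / 2 : ℝ) • totalDeriv S.cubicTerm u := by
  have hcubic := isDiffFun_cubicTerm (S := S)
  rw [hier_succ, hop_coeffM, coeffH_two, funext coeffM_two,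
    totalDeriv_add (isDiffFun_coe_eval 2).neg (hcubic.const_smul _), totalDeriv_neg,
    totalDeriv_coe_eval, totalDeriv_const_smul hcubic, lie_neg, sub_neg_eq_add]
  exact add_right_comm _ _ _

variable {c : ℝ} {I : Set ℝ} {q : ℝ → ℝ → S.𝔪}

theorem nls_iff : S.NLS c I q ↔ S.SmoothOn I q ∧ ∀ x, ∀ t ∈ I,
    c⁻¹ • (deriv (fun τ => q x τ) t : 𝔸) = S.hier 2 (S.jet (fun y => q y t) x) := by
  refine and_congr_right fun h => forall₃_congr fun x t ht => ?_
  rw [hier_two, jet_zero, iteratedDeriv_coe (h.contDiff_space ht)]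

theorem mkdv_iff : S.MKdV c I q ↔ S.SmoothOn I q ∧ ∀ x, ∀ t ∈ I,
    c⁻¹ • (deriv (fun τ => q x τ) t : 𝔸) = S.hier 3 (S.jet (fun y => q y t) x) := by
  refine and_congr_right fun h => forall₃_congr fun x t ht => ?_
  have hcubic : deriv (fun y => ⁅⁅S.A, (q y t : 𝔸)⁆, ⁅⁅S.A, (q y t : 𝔸)⁆, (q y t : 𝔸)⁆⁆) x =
      totalDeriv S.cubicTerm (S.jet (fun y => q y t) x) := by
    simpa only [cubicTerm, jet_zero] using
      (hasDerivAt_jet_comp isDiffFun_cubicTerm (h.contDiff_space ht) x).deriv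
  rw [hier_three, jet_zero, hcubic, ← iteratedDeriv_one (f := fun y => (q y t : 𝔸)),
    iteratedDeriv_coe (h.contDiff_space ht), iteratedDeriv_coe (h.contDiff_space ht)]

theorem isospectralFlow_two_iff_nls : S.IsospectralFlow 2 I q ↔ S.NLS 1 I q := by
  simp only [nls_iff, IsospectralFlow, inv_one, one_smul]

theorem isospectralFlow_three_iff_mkdv : S.IsospectralFlow 3 I q ↔ S.MKdV 1 I q := by
  simp only [mkdv_iff, IsospectralFlow, inv_one, one_smul]

end ExplicitFlows

section Constants

variable [FiniteDimensional ℝ 𝔸]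

/-- The projection of `𝔤` onto `𝔪` is `-ad(A)²`, and the trace of a projection is its rank. -/
theorem χ_eq_finrank : S.χ = Module.finrank ℝ (S.𝔪.comap (S.𝔤.incl : S.𝔤 →ₗ[ℝ] 𝔸)) := by
  set a : S.𝔤 := ⟨S.A, S.A_mem_𝔤⟩
  have hproj : LinearMap.IsProj (S.𝔪.comap (S.𝔤.incl : S.𝔤 →ₗ[ℝ] 𝔸))
      (-(LieAlgebra.ad ℝ S.𝔤 a ∘ₗ LieAlgebra.ad ℝ S.𝔤 a)) :=
    ⟨fun X => projM_mem X.2, fun X hX => Subtype.ext (neg_eq_iff_eq_neg.2 (S.ad_A_sq X hX))⟩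
  rw [← hproj.trace, map_neg, χ, killingForm_apply_apply]

theorem χ_pos : 0 < S.χ := by
  obtain ⟨X, hX, hX0⟩ := S.𝔪.exists_mem_ne_zero_of_ne_bot S.𝔪_ne_bot
  have : Nontrivial (S.𝔪.comap (S.𝔤.incl : S.𝔤 →ₗ[ℝ] 𝔸)) :=
    ⟨⟨⟨X, mem_𝔤_of_mem_𝔪 hX⟩, hX⟩, 0, fun h => hX0 (congrArg (fun Y => (Y.1 : 𝔸)) h)⟩
  rw [χ_eq_finrank]
  exact_mod_cast Module.finrank_pos

theorem sqrt_χ_pos : 0 < √S.χ := Real.sqrt_pos.2 χ_pos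

theorem κ_pos (n : ℕ) : 0 < S.κ n := Real.rpow_pos_of_pos χ_pos _

theorem κ_eq (n : ℕ) : S.κ n = √S.χ ^ n * S.χ⁻¹ := by
  rw [κ, Real.rpow_sub_one χ_pos.ne', Real.sqrt_eq_rpow, ← Real.rpow_natCast,
    ← Real.rpow_mul χ_pos.le, div_eq_mul_inv]
  ring_nf

theorem inv_χ_mul_inv_κ (n : ℕ) : S.χ⁻¹ * (S.κ n)⁻¹ = (√S.χ)⁻¹ ^ n := by
  have := (χ_pos (S := S)).ne'
  rw [κ_eq, mul_inv, inv_inv, inv_pow]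
  field_simp

end Constants

section Correspondence

variable {n : ℕ} {I : Set ℝ} {q Q : ℝ → ℝ → S.𝔪}

theorem isOpen_isoTimes (n : ℕ) (hI : IsOpen I) : IsOpen (S.isoTimes n I) :=
  hI.preimage (continuous_const.mul continuous_id)

theorem SmoothOn.rescale (h : S.SmoothOn I q) {I' : Set ℝ} (a : ℝ) {b : ℝ}
    (hb : ∀ t ∈ I', b * t ∈ I) (c : ℝ) : S.SmoothOn I' fun s t => c • q (a * s) (b * t) :=
  (h.comp (f := fun p : ℝ × ℝ => (a * p.1, b * p.2))
    ((contDiff_const.mul contDiff_fst).prodMk (contDiff_const.mul contDiff_snd)).contDiffOn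
    fun p hp => ⟨trivial, hb p.2 hp.2⟩).const_smul c

theorem jet_rescale {f : ℝ → S.𝔪} (hf : ContDiff ℝ ∞ f) (c r x : ℝ) :
    S.jet (fun y => c • f (r * y)) x = scale c r (S.jet f (r * x)) := by
  funext k
  have hfk : ContDiff ℝ k f := hf.of_le (by exact_mod_cast le_top)
  simp only [jet, scale, mul_smul]
  rw [iteratedDeriv_fun_const_smul_field, iteratedDeriv_comp_const_smul hfk]

variable [FiniteDimensional ℝ 𝔸]

theorem inv_κ_mul_mem_isoTimes {t : ℝ} (ht : t ∈ I) : (S.κ n)⁻¹ * t ∈ S.isoTimes n I := by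
  change S.κ n * ((S.κ n)⁻¹ * t) ∈ I
  rwa [mul_inv_cancel_left₀ (κ_pos n).ne']

namespace Corresponds

variable (h : S.Corresponds n q Q)

include h

theorem eq_smul :
    q = fun x τ => (-(√S.χ)⁻¹) • Q ((√S.χ)⁻¹ * x) ((S.κ n)⁻¹ * τ) := by
  funext x τ
  rw [neg_smul, ← h, mul_inv_cancel_left₀ sqrt_χ_pos.ne', mul_inv_cancel_left₀ (κ_pos n).ne']

theorem eq_smul_symm : Q = fun s t => (-√S.χ) • q (√S.χ * s) (S.κ n * t) := by
  funext s t
  rw [h, smul_neg, neg_smul, neg_neg, smul_smul, mul_inv_cancel₀ sqrt_χ_pos.ne', one_smul]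

theorem smoothOn_iff : S.SmoothOn I q ↔ S.SmoothOn (S.isoTimes n I) Q := by
  constructor
  · intro hq
    rw [h.eq_smul_symm]
    exact hq.rescale _ (fun t ht => ht) _
  · intro hQ
    rw [h.eq_smul]
    exact hQ.rescale _ (fun t => inv_κ_mul_mem_isoTimes) _

theorem jet_eq (hQ : S.SmoothOn (S.isoTimes n I) Q) {t : ℝ} (ht : t ∈ S.isoTimes n I) (s : ℝ) :
    S.jet (fun y => q y (S.κ n * t)) (√S.χ * s) =
      scale (-(√S.χ)⁻¹) (√S.χ)⁻¹ (S.jet (fun y => Q y t) s) := by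
  simp only [h.eq_smul, inv_mul_cancel_left₀ (κ_pos n).ne']
  rw [jet_rescale (f := fun y => Q y t) (hQ.contDiff_space ht),
    inv_mul_cancel_left₀ sqrt_χ_pos.ne']

theorem deriv_time_eq (s t : ℝ) : deriv (fun τ => (q (√S.χ * s) τ : 𝔸)) (S.κ n * t) =
    (-(√S.χ)⁻¹ * (S.κ n)⁻¹) • deriv (fun τ => (Q s τ : 𝔸)) t := by
  simp only [h.eq_smul, inv_mul_cancel_left₀ sqrt_χ_pos.ne', Submodule.coe_smul]
  rw [deriv_fun_const_smul_field, deriv_comp_mul_left _ (fun τ => (Q s τ : 𝔸)),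
    inv_mul_cancel_left₀ (κ_pos n).ne', smul_smul]

theorem mergedFlow_eq_iff (hQ : S.SmoothOn (S.isoTimes n I) Q) {t : ℝ}
    (ht : t ∈ S.isoTimes n I) (s : ℝ) :
    S.χ⁻¹ • deriv (fun τ => (q (√S.χ * s) τ : 𝔸)) (S.κ n * t) =
        S.hier n (S.jet (fun y => q y (S.κ n * t)) (√S.χ * s)) ↔
      deriv (fun τ => (Q s τ : 𝔸)) t = S.hier n (S.jet (fun y => Q y t) s) := by
  have hr : (√S.χ)⁻¹ ≠ 0 := inv_ne_zero sqrt_χ_pos.ne'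
  rw [h.jet_eq hQ ht, hier_scale (neg_sq _) hr, h.deriv_time_eq, smul_smul, mul_left_comm,
    inv_χ_mul_inv_κ]
  exact (smul_right_injective 𝔸 (mul_ne_zero (neg_ne_zero.2 hr) (pow_ne_zero n hr))).eq_iff

theorem mergedFlow_iff : S.MergedFlow n I q ↔ S.IsospectralFlow n (S.isoTimes n I) Q := by
  rw [MergedFlow, IsospectralFlow, h.smoothOn_iff]
  refine and_congr_right fun hQ => ⟨fun hq s t ht => ?_, fun hQt x τ hτ => ?_⟩
  · exact (h.mergedFlow_eq_iff hQ ht s).1 (hq _ _ ht)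
  · have ht := inv_κ_mul_mem_isoTimes (S := S) (n := n) hτ
    have hq := (h.mergedFlow_eq_iff hQ ht ((√S.χ)⁻¹ * x)).2 (hQt _ _ ht)
    rwa [mul_inv_cancel_left₀ (κ_pos n).ne', mul_inv_cancel_left₀ sqrt_χ_pos.ne'] at hq

end Corresponds

end Correspondence

section AdjointAction

/-- The adjoint action `X ↦ g X g⁻¹` of a unit. -/
def Ad (g : 𝔸ˣ) : 𝔸 →L[ℝ] 𝔸 := ContinuousLinearMap.mulLeftRight ℝ 𝔸 g ↑g⁻¹

theorem Ad_apply (g : 𝔸ˣ) (X : 𝔸) : Ad g X = g * X * ↑g⁻¹ := rfl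

theorem Ad_lie (g : 𝔸ˣ) (X Y : 𝔸) : Ad g ⁅X, Y⁆ = ⁅Ad g X, Ad g Y⁆ := by
  simp only [LieRing.of_associative_ring_bracket, map_sub, Ad_apply, mul_assoc,
    Units.inv_mul_cancel_left]

theorem Ad_A {g : 𝔸ˣ} (hg : g ∈ S.H) : Ad g S.A = S.A := by
  rw [Ad_apply, hg.2, mul_assoc, Units.mul_inv, mul_one]

variable [FiniteDimensional ℝ 𝔸]

theorem Ad_mem_𝔤 {g : 𝔸ˣ} (hg : g ∈ S.G) {X : 𝔸} (hX : X ∈ S.𝔤) : Ad g X ∈ S.𝔤 := by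
  have : CompleteSpace 𝔸 := FiniteDimensional.complete ℝ 𝔸
  let _ : NormedAlgebra ℚ 𝔸 := NormedAlgebra.restrictScalars ℚ ℝ 𝔸
  rw [S.mem_𝔤_iff] at hX ⊢
  intro r
  obtain ⟨k, hk, h⟩ := hX r
  refine ⟨g * k * g⁻¹, S.G.mul_mem (S.G.mul_mem hg hk) (S.G.inv_mem hg), ?_⟩
  rw [← map_smul, Ad_apply, NormedSpace.exp_units_conj, Units.val_mul, Units.val_mul, h]

theorem Ad_mem_𝔪 {g : 𝔸ˣ} (hg : g ∈ S.H) {X : 𝔸} (hX : X ∈ S.𝔪) : Ad g X ∈ S.𝔪 := by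
  have hprojM : S.projM (Ad g X) = Ad g X := by
    rw [projM, ← Ad_A hg, ← Ad_lie, ← Ad_lie, S.ad_A_sq X hX, map_neg, neg_neg]
  exact hprojM ▸ projM_mem (Ad_mem_𝔤 hg.1 (mem_𝔤_of_mem_𝔪 hX))

variable {g : 𝔸ˣ} (hg : g ∈ S.H)

/-- The adjoint action of the stabilizer group `H` on `𝔪`. -/
def Ad𝔪 : S.𝔪 →L[ℝ] S.𝔪 :=
  LinearMap.toContinuousLinearMap ((Ad g).toLinearMap.restrict fun _ => Ad_mem_𝔪 hg)

theorem coe_Ad𝔪 (X : S.𝔪) : (Ad𝔪 hg X : 𝔸) = Ad g X := rfl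

theorem cubicTerm_Ad𝔪 (u : S.Jet) :
    S.cubicTerm (fun k => Ad𝔪 hg (u k)) = Ad g (S.cubicTerm u) := by
  simp only [cubicTerm, Ad_lie, Ad_A hg, coe_Ad𝔪]

theorem totalDeriv_cubicTerm_Ad𝔪 (u : S.Jet) :
    totalDeriv S.cubicTerm (fun k => Ad𝔪 hg (u k)) = Ad g (totalDeriv S.cubicTerm u) := by
  rw [← totalDeriv_clm isDiffFun_cubicTerm]
  simp only [totalDeriv, ← cubicTerm_Ad𝔪 hg, map_add, map_smul]

theorem hier_two_Ad𝔪 (u : S.Jet) :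
    S.hier 2 (fun k => Ad𝔪 hg (u k)) = Ad g (S.hier 2 u) := by
  simp only [hier_two, coe_Ad𝔪, map_add, map_neg, map_smul, Ad_lie, Ad_A hg]

theorem hier_three_Ad𝔪 (u : S.Jet) :
    S.hier 3 (fun k => Ad𝔪 hg (u k)) = Ad g (S.hier 3 u) := by
  simp only [hier_three, coe_Ad𝔪, totalDeriv_cubicTerm_Ad𝔪, map_add, map_neg, map_smul, Ad_lie]

variable {c : ℝ} {I : Set ℝ} {Q : ℝ → ℝ → S.𝔪}

theorem SmoothOn.flow_Ad𝔪 {n : ℕ} (hn : ∀ u : S.Jet,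
    S.hier n (fun k => Ad𝔪 hg (u k)) = Ad g (S.hier n u)) (hI : IsOpen I)
    (h : S.SmoothOn I Q) {x t : ℝ} (ht : t ∈ I)
    (hflow : c⁻¹ • (deriv (fun τ => Q x τ) t : 𝔸) = S.hier n (S.jet (fun y => Q y t) x)) :
    c⁻¹ • (deriv (fun τ => Ad𝔪 hg (Q x τ)) t : 𝔸) =
      S.hier n (S.jet (fun y => Ad𝔪 hg (Q y t)) x) := by
  have hjet : S.jet (fun y => Ad𝔪 hg (Q y t)) x = fun k => Ad𝔪 hg (S.jet (fun y => Q y t) x k) :=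
    funext fun k => iteratedDeriv_clm_comp (Ad𝔪 hg) (h.contDiff_space ht) k x
  have hderiv : deriv (fun τ => (Ad𝔪 hg (Q x τ) : 𝔸)) t = Ad g (deriv (fun τ => (Q x τ : 𝔸)) t) :=
    ((Ad g).hasFDerivAt.comp_hasDerivAt t (h.differentiableAt_time hI ht x).hasDerivAt).deriv
  rw [hjet, hn, ← hflow, map_smul, hderiv]

theorem SmoothOn.Ad𝔪 (h : S.SmoothOn I Q) : S.SmoothOn I fun s t => Ad𝔪 hg (Q s t) :=
  (HermitianSymmetric.Ad𝔪 hg).contDiff.comp_contDiffOn h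

theorem NLS.Ad𝔪 (hI : IsOpen I) (h : S.NLS c I Q) : S.NLS c I fun s t => Ad𝔪 hg (Q s t) :=
  nls_iff.2 ⟨h.1.Ad𝔪 hg, fun x t ht =>
    h.1.flow_Ad𝔪 hg (hier_two_Ad𝔪 hg) hI ht ((nls_iff.1 h).2 x t ht)⟩

theorem MKdV.Ad𝔪 (hI : IsOpen I) (h : S.MKdV c I Q) : S.MKdV c I fun s t => Ad𝔪 hg (Q s t) :=
  mkdv_iff.2 ⟨h.1.Ad𝔪 hg, fun x t ht =>
    h.1.flow_Ad𝔪 hg (hier_three_Ad𝔪 hg) hI ht ((mkdv_iff.1 h).2 x t ht)⟩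

end AdjointAction

end HermitianSymmetric

section Calculus

open Filter Topology

variable {E R : Type*} [NormedAddCommGroup E] [NormedSpace ℝ E]

theorem hasDerivAt_comp_mul_left {f : ℝ → E} {f' : E} {c x : ℝ} (hf : HasDerivAt f f' (c * x)) :
    HasDerivAt (fun y => f (c * y)) (c • f') x :=
  hf.scomp x (hasDerivAt_const_mul c)

theorem hasDerivAt_comp_mul_left_iff {f : ℝ → E} {f' : E} {c x : ℝ} (hc : c ≠ 0) :
    HasDerivAt (fun y => f (c * y)) (c • f') x ↔ HasDerivAt f f' (c * x) := by
  refine ⟨fun h => ?_, hasDerivAt_comp_mul_left⟩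
  rw [← inv_mul_cancel_left₀ hc x] at h
  simpa [hc, smul_smul] using hasDerivAt_comp_mul_left h

section Rescaling

variable {a b : ℝ} (ha : a ≠ 0) (hb : b ≠ 0) {I : Set ℝ}

include ha hb

theorem forall_mul_left_iff {P : ℝ → ℝ → Prop} :
    (∀ s, ∀ t ∈ (b * ·) ⁻¹' I, P (a * s) (b * t)) ↔ ∀ x, ∀ τ ∈ I, P x τ := by
  refine ⟨fun h x τ hτ => ?_, fun h s t ht => h _ _ ht⟩
  have := h (a⁻¹ * x) (b⁻¹ * τ) (by rwa [Set.mem_preimage, mul_inv_cancel_left₀ hb])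
  rwa [mul_inv_cancel_left₀ ha, mul_inv_cancel_left₀ hb] at this

variable {f f' f'' : ℝ → ℝ → E}

theorem forall_hasDerivAt_fst_rescale_iff
    (hf : ∀ s, ∀ t ∈ (b * ·) ⁻¹' I, f'' s t = a • f' (a * s) (b * t)) :
    (∀ s, ∀ t ∈ (b * ·) ⁻¹' I, HasDerivAt (fun σ => f (a * σ) (b * t)) (f'' s t) s) ↔
      ∀ x, ∀ τ ∈ I, HasDerivAt (fun σ => f σ τ) (f' x τ) x := by
  rw [← forall_mul_left_iff ha hb (P := fun x τ => HasDerivAt (fun σ => f σ τ) (f' x τ) x)]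
  refine forall₃_congr fun s t ht => ?_
  rw [hf s t ht]
  exact hasDerivAt_comp_mul_left_iff (f := fun σ => f σ (b * t)) ha

theorem forall_hasDerivAt_snd_rescale_iff
    (hf : ∀ s, ∀ t ∈ (b * ·) ⁻¹' I, f'' s t = b • f' (a * s) (b * t)) :
    (∀ s, ∀ t ∈ (b * ·) ⁻¹' I, HasDerivAt (fun τ => f (a * s) (b * τ)) (f'' s t) t) ↔
      ∀ x, ∀ τ ∈ I, HasDerivAt (fun τ => f x τ) (f' x τ) τ := by
  rw [← forall_mul_left_iff ha hb (P := fun x τ => HasDerivAt (fun τ => f x τ) (f' x τ) τ)]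
  refine forall₃_congr fun s t ht => ?_
  rw [hf s t ht]
  exact hasDerivAt_comp_mul_left_iff hb

end Rescaling

theorem eq_of_hasDerivAt_eq_zero {F : ℝ → ℝ → E} {I : Set ℝ} (hI : IsOpen I)
    (hI' : IsPreconnected I) (hs : ∀ s, ∀ t ∈ I, HasDerivAt (fun σ => F σ t) 0 s)
    (ht : ∀ s, ∀ t ∈ I, HasDerivAt (fun τ => F s τ) 0 t) (s s' : ℝ) {t t' : ℝ} (h : t ∈ I)
    (h' : t' ∈ I) : F s t = F s' t' :=
  calc F s t = F s' t := is_const_of_deriv_eq_zero (fun σ => (hs σ t h).differentiableAt)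
        (fun σ => (hs σ t h).deriv) s s'
    _ = F s' t' := hI.is_const_of_deriv_eq_zero hI'
        (fun τ hτ => (ht s' τ hτ).differentiableAt.differentiableWithinAt)
        (fun τ hτ => (ht s' τ hτ).deriv) h h'

section Slices

variable {F : ℝ → ℝ → E} {I : Set ℝ} (hI : IsOpen I)
  (hF : ContDiffOn ℝ 1 (fun p : ℝ × ℝ => F p.1 p.2) (Set.univ ×ˢ I)) (x : ℝ) {t : ℝ} (ht : t ∈ I)

include hI hF ht

theorem differentiableAt_of_contDiffOn_univ_prod :
    DifferentiableAt ℝ (fun p : ℝ × ℝ => F p.1 p.2) (x, t) :=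
  (hF.contDiffAt ((isOpen_univ.prod hI).mem_nhds ⟨trivial, ht⟩)).differentiableAt one_ne_zero

theorem differentiableAt_fst_slice : DifferentiableAt ℝ (fun y => F y t) x :=
  (differentiableAt_of_contDiffOn_univ_prod hI hF x ht).comp (f := fun y => (y, t)) x
    (by fun_prop)

theorem differentiableAt_snd_slice : DifferentiableAt ℝ (fun τ => F x τ) t :=
  (differentiableAt_of_contDiffOn_univ_prod hI hF x ht).comp (f := fun τ => (x, τ)) t
    (by fun_prop)

end Slices

section MixedPartials

variable {F : ℝ → ℝ → E} {a b : ℝ}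

theorem hasDerivAt_fst_slice {f : ℝ × ℝ → E} {f' : ℝ × ℝ →L[ℝ] E} (hf : HasFDerivAt f f' (a, b)) :
    HasDerivAt (fun x => f (x, b)) (f' (1, 0)) a :=
  hf.comp_hasDerivAt a ((hasDerivAt_id a).prodMk (hasDerivAt_const a b))

theorem hasDerivAt_snd_slice {f : ℝ × ℝ → E} {f' : ℝ × ℝ →L[ℝ] E} (hf : HasFDerivAt f f' (a, b)) :
    HasDerivAt (fun y => f (a, y)) (f' (0, 1)) b :=
  hf.comp_hasDerivAt b ((hasDerivAt_const b a).prodMk (hasDerivAt_id b))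

theorem hasDerivAt_deriv_comm (hF : ContDiffAt ℝ 2 (fun p : ℝ × ℝ => F p.1 p.2) (a, b)) {F' : E}
    (hF' : HasDerivAt (fun y => deriv (fun x => F x y) a) F' b) :
    HasDerivAt (fun x => deriv (fun y => F x y) b) F' a := by
  set f : ℝ × ℝ → E := fun p => F p.1 p.2
  have hd : ∀ᶠ p in 𝓝 (a, b), DifferentiableAt ℝ f p :=
    (hF.eventually (by simp)).mono fun p hp => hp.differentiableAt (by simp)
  have hd2 : HasFDerivAt (fderiv ℝ f) (fderiv ℝ (fderiv ℝ f) (a, b)) (a, b) :=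
    ((hF.fderiv_right (m := 1) (by norm_num)).differentiableAt (by simp)).hasFDerivAt
  have hx : (fun x => deriv (fun y => F x y) b) =ᶠ[𝓝 a] fun x => fderiv ℝ f (x, b) (0, 1) := by
    filter_upwards [(Continuous.prodMk_left b).continuousAt.eventually hd] with x hx
    exact (hasDerivAt_snd_slice hx.hasFDerivAt).deriv
  have hy : (fun y => deriv (fun x => F x y) a) =ᶠ[𝓝 b] fun y => fderiv ℝ f (a, y) (1, 0) := by
    filter_upwards [(Continuous.prodMk_right a).continuousAt.eventually hd] with y hy
    exact (hasDerivAt_fst_slice hy.hasFDerivAt).deriv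
  have hyx := (hasDerivAt_snd_slice hd2).clm_apply (hasDerivAt_const b ((1 : ℝ), (0 : ℝ)))
  have hxy := (hasDerivAt_fst_slice hd2).clm_apply (hasDerivAt_const a ((0 : ℝ), (1 : ℝ)))
  have hsymm := hF.isSymmSndFDerivAt (by simp) (1, 0) (0, 1)
  simp only [map_zero, add_zero] at hyx hxy
  rw [hF'.unique (hyx.congr_of_eventuallyEq hy), ← hsymm]
  exact hxy.congr_of_eventuallyEq hx

end MixedPartials

variable [NormedRing R] [NormedAlgebra ℝ R] [CompleteSpace R]

theorem hasDerivAt_units_inv {g : ℝ → Rˣ} {x : ℝ} {g' : R}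
    (hg : HasDerivAt (fun y => (g y : R)) g' x) :
    HasDerivAt (fun y => (↑(g y)⁻¹ : R)) (-(↑(g x)⁻¹ * g' * ↑(g x)⁻¹)) x := by
  have h := (hasFDerivAt_ringInverse (𝕜 := ℝ) (g x)).comp_hasDerivAt x hg
  simpa [Function.comp_def] using h

theorem contDiffOn_units_inv {g : E → Rˣ} {s : Set E} {n : ℕ∞}
    (hg : ContDiffOn ℝ n (fun y => (g y : R)) s) :
    ContDiffOn ℝ n (fun y => (↑(g y)⁻¹ : R)) s := by
  simp only [← Ring.inverse_unit]
  exact fun y hy => (contDiffAt_ringInverse ℝ (g y)).comp_contDiffWithinAt (f := fun y => (g y : R))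
    y (hg y hy)

/-- Near `1` the curve is `l ↦ exp (Y l)` with `Y' 0 = X`, and `exp (Y l) ^ n = exp (n • Y l)`. -/
theorem tendsto_pow_exp_of_hasDerivAt {g : ℝ → R} {X : R} (hg0 : g 0 = 1)
    (hg : HasDerivAt g X 0) :
    Tendsto (fun n : ℕ => g (n : ℝ)⁻¹ ^ n) atTop (𝓝 (NormedSpace.exp X)) := by
  let _ : NormedAlgebra ℚ R := NormedAlgebra.restrictScalars ℚ ℝ R
  have hexp : HasStrictFDerivAt (NormedSpace.exp : R → R)
      ((ContinuousLinearEquiv.refl ℝ R : R ≃L[ℝ] R) : R →L[ℝ] R) 0 := hasStrictFDerivAt_exp_zero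
  have hlog := hexp.to_localInverse.hasFDerivAt
  have hexp_log := hexp.eventually_right_inverse
  have hlog_one := hexp.localInverse_apply_image
  rw [NormedSpace.exp_zero, ← hg0] at hlog hexp_log hlog_one
  have hinv : Tendsto (fun n : ℕ => (n : ℝ)⁻¹) atTop (𝓝[≠] 0) :=
    (tendsto_inv_atTop_nhdsGT_zero.mono_right (nhdsGT_le_nhdsNE 0)).comp
      tendsto_natCast_atTop_atTop
  have hslope := (hlog.comp_hasDerivAt 0 hg).tendsto_slope_zero.comp hinv
  refine Tendsto.congr' ?_ ((NormedSpace.exp_continuous.tendsto X).comp hslope)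
  filter_upwards [(hinv.mono_right nhdsWithin_le_nhds).eventually
    (hg.continuousAt.eventually hexp_log)] with n hn
  simp only [Function.comp_apply, inv_inv, zero_add, hlog_one, sub_zero]
  rw [Nat.cast_smul_eq_nsmul, NormedSpace.exp_nsmul, hn]

theorem exists_mem_eq_exp_smul {G : Subgroup Rˣ} (hG : IsCompact (G : Set Rˣ)) {g : ℝ → Rˣ}
    (hg : ∀ l, g l ∈ G) (hg0 : g 0 = 1) {X : R} (hX : HasDerivAt (fun l => (g l : R)) X 0)
    (r : ℝ) : ∃ k ∈ G, (k : R) = NormedSpace.exp (r • X) := by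
  have hclosed : IsClosed ((fun k : Rˣ => (k : R)) '' G) :=
    (hG.image Units.continuous_val).isClosed
  rw [← mul_zero r] at hX
  refine hclosed.mem_of_tendsto
    (tendsto_pow_exp_of_hasDerivAt (by simp [hg0]) (hasDerivAt_comp_mul_left hX))
    (Eventually.of_forall fun n => ⟨g (r * (n : ℝ)⁻¹) ^ n, G.pow_mem (hg _) n, ?_⟩)
  exact Units.val_pow_eq_pow_val _ _

end Calculus

namespace HermitianSymmetric

variable {𝔸 : Type*} [NormedRing 𝔸] [NormedAlgebra ℝ 𝔸] {S : HermitianSymmetric 𝔸}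

section FrameCoefficients

theorem IsPrimitive.const_smul {p f : S.Jet → 𝔸} (h : S.IsPrimitive p f) (c : ℝ) :
    S.IsPrimitive (c • p) (c • f) :=
  isPrimitive_of_totalDeriv_eq (IsDiffFun.const_smul h.1 c)
    (fun u => (totalDeriv_const_smul h.1 c u).trans (congrArg (c • ·) (congrFun h.2.1 u)))
    ((congrArg (c • ·) h.2.2).trans (smul_zero c))

theorem adVar_const_smul (c : ℝ) (F : S.Jet → 𝔸) : S.adVar (c • F) = c • S.adVar F :=
  funext fun u => lie_smul c (u 0 : 𝔸) (F u)

variable [FiniteDimensional ℝ 𝔸]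

theorem dinv_adVar_const_smul_coeffM (c : ℝ) (n : ℕ) :
    S.Dinv (S.adVar (c • S.coeffM n)) = c • S.coeffH n := by
  rw [adVar_const_smul]
  exact ((isPrimitive_coeffH n).const_smul c).dinv_eq

theorem hop_neg_coeffM (n : ℕ) : S.Hop (-S.coeffM n) = -S.Hop (S.coeffM n) := by
  have h := dinv_adVar_const_smul_coeffM (S := S) (-1) n
  rw [neg_one_smul, neg_one_smul] at h
  funext u
  change totalDeriv (fun u => -S.coeffM n u) u - ⁅(u 0 : 𝔸), S.Dinv (S.adVar (-S.coeffM n)) u⁆ = _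
  rw [h, totalDeriv_neg, Pi.neg_apply, lie_neg, ← neg_sub', Pi.neg_apply, hop_coeffM]

theorem jinv_hUp (n : ℕ) : S.Jinv (S.hUp (n + 2)) = -S.coeffM n := by
  rw [← jinv_hier]
  funext u
  exact congrArg Neg.neg (lie_neg _ _)

theorem J_hUp (n : ℕ) : S.J (S.hUp (n + 2)) = S.coeffM n := by
  rw [← jinv_hier]
  funext u
  exact lie_neg _ _

theorem hPerp_eq (n : ℕ) (u : S.Jet) : S.hPerp (n + 2) u = -√S.χ • S.coeffM n u := by
  rw [hPerp, jinv_hUp, Pi.smul_apply, Pi.neg_apply, smul_neg, neg_smul]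

theorem hPar_eq (n : ℕ) (u : S.Jet) : S.hPar (n + 2) u = √S.χ • S.coeffH n u := by
  rw [hPar, J_hUp, Pi.smul_apply, coeffH]

theorem wPerp_eq (n : ℕ) : S.wPerp (n + 2) = S.χ • S.coeffM (n + 1) := by
  rw [wPerp, Jop, jinv_hUp, hop_neg_coeffM, coeffM_succ]
  refine congrArg (S.χ • ·) (funext fun u => ?_)
  exact lie_neg _ _

theorem wPar_eq (n : ℕ) (u : S.Jet) : S.wPar (n + 2) u = -S.χ • S.coeffH (n + 1) u := by
  rw [wPar, wPerp_eq, dinv_adVar_const_smul_coeffM, Pi.neg_apply, Pi.smul_apply, neg_smul]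

end FrameCoefficients

section LaxPairAtZero

theorem laxU_zero (u : S.Jet) : S.laxU 0 u = u 0 := by rw [laxU, zero_smul, zero_add]

theorem hasDerivAt_laxU (u : S.Jet) (l : ℝ) : HasDerivAt (fun l => S.laxU l u) S.A l := by
  have h := ((hasDerivAt_id l).smul_const S.A).add_const (u 0 : 𝔸)
  rwa [one_smul] at h

theorem laxV_succ_zero (n : ℕ) (u : S.Jet) :
    S.laxV (n + 1) 0 u = S.coeffM n u + S.coeffH n u := by
  simp only [laxV_succ, zero_smul, zero_add]

theorem differentiable_laxV (n : ℕ) (u : S.Jet) : Differentiable ℝ fun l => S.laxV n l u :=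
  ((differentiable_id.pow n).smul_const S.A).add
    (Differentiable.fun_sum fun k _ => (differentiable_id.pow k).smul_const _)

theorem deriv_laxV (n : ℕ) (u : S.Jet) :
    deriv (fun l => S.laxV (n + 2) l u) 0 = S.coeffM n u + S.coeffH n u := by
  have h := ((hasDerivAt_id (0 : ℝ)).smul (differentiable_laxV (n + 1) u 0).hasDerivAt).add_const
    (S.coeffM (n + 1) u + S.coeffH (n + 1) u)
  simp only [laxV_succ (n + 1)]
  refine h.deriv.trans ?_
  rw [id_eq, zero_smul, zero_add, one_smul, laxV_succ_zero]

end LaxPairAtZero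

section CorrespondingCoefficients

variable [FiniteDimensional ℝ 𝔸]

theorem κ_mul_χ_mul_inv_sqrt_pow (n : ℕ) : S.κ n * S.χ * (√S.χ)⁻¹ ^ n = 1 := by
  rw [κ_eq, inv_mul_cancel_right₀ χ_pos.ne', ← mul_pow, mul_inv_cancel₀ sqrt_χ_pos.ne', one_pow]

theorem κ_mul_sqrt_χ_mul_inv_sqrt_pow (n : ℕ) : S.κ (n + 1) * √S.χ * (√S.χ)⁻¹ ^ n = 1 := by
  have hχ : √S.χ * (√S.χ)⁻¹ ^ n = S.χ * (√S.χ)⁻¹ ^ (n + 1) := by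
    rw [pow_succ', ← mul_assoc, ← div_eq_mul_inv, Real.div_sqrt]
  rw [mul_assoc, hχ, ← mul_assoc, κ_mul_χ_mul_inv_sqrt_pow]

namespace Corresponds

variable {n : ℕ} {I : Set ℝ} {q Q : ℝ → ℝ → S.𝔪} (h : S.Corresponds (n + 2) q Q)
  (hQ : S.SmoothOn (S.isoTimes (n + 2) I) Q) {t : ℝ} (ht : t ∈ S.isoTimes (n + 2) I) (s : ℝ)

include h hQ ht

theorem coeffM_eq (k : ℕ) :
    S.coeffM k (S.jet (fun y => q y (S.κ (n + 2) * t)) (√S.χ * s)) =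
      -(√S.χ)⁻¹ ^ (k + 1) • S.coeffM k (S.jet (fun y => Q y t) s) := by
  rw [h.jet_eq hQ ht, coeffM_scale (neg_sq _) (inv_ne_zero sqrt_χ_pos.ne'), pow_succ', neg_mul]

theorem coeffH_eq (k : ℕ) :
    S.coeffH k (S.jet (fun y => q y (S.κ (n + 2) * t)) (√S.χ * s)) =
      (√S.χ)⁻¹ ^ (k + 1) • S.coeffH k (S.jet (fun y => Q y t) s) := by
  rw [h.jet_eq hQ ht, coeffH_scale (neg_sq _) (inv_ne_zero sqrt_χ_pos.ne')]

theorem laxVm_one : S.laxVm (n + 2) 1 (S.jet (fun y => Q y t) s) =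
    S.κ (n + 2) • S.hPerp (n + 2) (S.jet (fun y => q y (S.κ (n + 2) * t)) (√S.χ * s)) := by
  rw [hPerp_eq, h.coeffM_eq hQ ht, smul_smul, smul_smul, mul_neg, mul_neg, neg_mul, neg_neg,
    κ_mul_sqrt_χ_mul_inv_sqrt_pow, one_smul]
  rfl

theorem laxVh_one : S.laxVh (n + 2) 1 (S.jet (fun y => Q y t) s) =
    S.κ (n + 2) • S.hPar (n + 2) (S.jet (fun y => q y (S.κ (n + 2) * t)) (√S.χ * s)) := by
  rw [hPar_eq, h.coeffH_eq hQ ht, smul_smul, smul_smul,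
    κ_mul_sqrt_χ_mul_inv_sqrt_pow, one_smul]
  rfl

theorem laxVm_zero : S.laxVm (n + 2) 0 (S.jet (fun y => Q y t) s) =
    -(S.κ (n + 2) • S.wPerp (n + 2) (S.jet (fun y => q y (S.κ (n + 2) * t)) (√S.χ * s))) := by
  rw [wPerp_eq, Pi.smul_apply, h.coeffM_eq hQ ht, neg_smul, smul_neg, smul_neg, neg_neg,
    smul_smul, smul_smul, κ_mul_χ_mul_inv_sqrt_pow, one_smul]
  rfl

theorem laxVh_zero : S.laxVh (n + 2) 0 (S.jet (fun y => Q y t) s) =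
    -(S.κ (n + 2) • S.wPar (n + 2) (S.jet (fun y => q y (S.κ (n + 2) * t)) (√S.χ * s))) := by
  rw [wPar_eq, h.coeffH_eq hQ ht, neg_smul, smul_neg, neg_neg, smul_smul, smul_smul,
    κ_mul_χ_mul_inv_sqrt_pow, one_smul]
  rfl

theorem deriv_laxV_eq : deriv (fun l => S.laxV (n + 2) l (S.jet (fun y => Q y t) s)) 0 =
    S.κ (n + 2) • (S.hPerp (n + 2) (S.jet (fun y => q y (S.κ (n + 2) * t)) (√S.χ * s)) +
      S.hPar (n + 2) (S.jet (fun y => q y (S.κ (n + 2) * t)) (√S.χ * s))) := by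
  rw [deriv_laxV, smul_add, ← h.laxVm_one hQ ht, ← h.laxVh_one hQ ht]
  rfl

theorem neg_laxV_zero_eq : -S.laxV (n + 2) 0 (S.jet (fun y => Q y t) s) =
    S.κ (n + 2) • (S.wPerp (n + 2) (S.jet (fun y => q y (S.κ (n + 2) * t)) (√S.χ * s)) +
      S.wPar (n + 2) (S.jet (fun y => q y (S.κ (n + 2) * t)) (√S.χ * s))) := by
  rw [laxV_succ_zero, neg_eq_iff_eq_neg, smul_add, neg_add, ← h.laxVm_zero hQ ht,
    ← h.laxVh_zero hQ ht]
  rfl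

end Corresponds

end CorrespondingCoefficients

end HermitianSymmetric

namespace HermitianSymmetric

section FrameEquations

variable {R : Type*} [NormedRing R] [NormedAlgebra ℝ R]

/-- The frame equations `ψ⁻¹ dψ = w` and `Ad(ψ⁻¹) dγ = e` for a moving frame `ψ` along a curve `γ`,
where `w` has components `w₁`, `w₂` and `e` has components `e₁`, `e₂` in the two variables; the
second variable ranges over `I`. -/
structure FrameEquations (I : Set ℝ) (w₁ w₂ e₁ e₂ : ℝ → ℝ → R) (ψ : ℝ → ℝ → Rˣ)
    (γ : ℝ → ℝ → R) : Prop where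
  frame_fst : ∀ s, ∀ t ∈ I, HasDerivAt (fun σ => (ψ σ t : R)) (ψ s t * w₁ s t) s
  frame_snd : ∀ s, ∀ t ∈ I, HasDerivAt (fun τ => (ψ s τ : R)) (ψ s t * w₂ s t) t
  curve_fst : ∀ s, ∀ t ∈ I, HasDerivAt (fun σ => γ σ t) (Ad (ψ s t) (e₁ s t)) s
  curve_snd : ∀ s, ∀ t ∈ I, HasDerivAt (fun τ => γ s τ) (Ad (ψ s t) (e₂ s t)) t

theorem Ad_mul_apply (g h : Rˣ) (X : R) : Ad (g * h) X = Ad g (Ad h X) := by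
  simp only [Ad_apply, mul_inv_rev, Units.val_mul, mul_assoc]

theorem hasDerivAt_mul_inv_eq_zero [CompleteSpace R] {ψ ψ' : ℝ → Rˣ} {w : R} {x : ℝ}
    (h : HasDerivAt (fun y => (ψ y : R)) (ψ x * w) x)
    (h' : HasDerivAt (fun y => (ψ' y : R)) (ψ' x * w) x) :
    HasDerivAt (fun y => (ψ y * ↑(ψ' y)⁻¹ : R)) 0 x := by
  have hmul := h.mul (hasDerivAt_units_inv h')
  rwa [Units.inv_mul_cancel_left, mul_neg, ← mul_assoc, add_neg_cancel] at hmul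

namespace FrameEquations

variable {I : Set ℝ} {w₁ w₂ e₁ e₂ w₁' w₂' e₁' e₂' : ℝ → ℝ → R} {ψ ψ' : ℝ → ℝ → Rˣ}
  {γ γ' : ℝ → ℝ → R}

theorem rescale_iff {a b : ℝ} (ha : a ≠ 0) (hb : b ≠ 0)
    (hw₁ : ∀ s, ∀ t ∈ (b * ·) ⁻¹' I, w₁' s t = a • w₁ (a * s) (b * t))
    (hw₂ : ∀ s, ∀ t ∈ (b * ·) ⁻¹' I, w₂' s t = b • w₂ (a * s) (b * t))
    (he₁ : ∀ s, ∀ t ∈ (b * ·) ⁻¹' I, e₁' s t = a • e₁ (a * s) (b * t))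
    (he₂ : ∀ s, ∀ t ∈ (b * ·) ⁻¹' I, e₂' s t = b • e₂ (a * s) (b * t)) :
    FrameEquations ((b * ·) ⁻¹' I) w₁' w₂' e₁' e₂' (fun s t => ψ (a * s) (b * t))
      (fun s t => γ (a * s) (b * t)) ↔ FrameEquations I w₁ w₂ e₁ e₂ ψ γ := by
  have hψ₁ := forall_hasDerivAt_fst_rescale_iff ha hb (I := I) (f := fun s t => (ψ s t : R))
    (f' := fun s t => ψ s t * w₁ s t)
    (fun s t ht => (congrArg (_ * ·) (hw₁ s t ht)).trans (mul_smul_comm _ _ _))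
  have hψ₂ := forall_hasDerivAt_snd_rescale_iff ha hb (I := I) (f := fun s t => (ψ s t : R))
    (f' := fun s t => ψ s t * w₂ s t)
    (fun s t ht => (congrArg (_ * ·) (hw₂ s t ht)).trans (mul_smul_comm _ _ _))
  have hγ₁ := forall_hasDerivAt_fst_rescale_iff ha hb (I := I) (f := γ)
    (f' := fun s t => Ad (ψ s t) (e₁ s t))
    (fun s t ht => (congrArg (Ad _) (he₁ s t ht)).trans (map_smul _ _ _))
  have hγ₂ := forall_hasDerivAt_snd_rescale_iff ha hb (I := I) (f := γ)
    (f' := fun s t => Ad (ψ s t) (e₂ s t))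
    (fun s t ht => (congrArg (Ad _) (he₂ s t ht)).trans (map_smul _ _ _))
  exact ⟨fun h => ⟨hψ₁.1 h.1, hψ₂.1 h.2, hγ₁.1 h.3, hγ₂.1 h.4⟩,
    fun h => ⟨hψ₁.2 h.1, hψ₂.2 h.2, hγ₁.2 h.3, hγ₂.2 h.4⟩⟩

theorem congr_curve (hI : IsOpen I) (hγ : ∀ s, ∀ t ∈ I, γ' s t = γ s t)
    (h : FrameEquations I w₁ w₂ e₁ e₂ ψ γ) : FrameEquations I w₁ w₂ e₁ e₂ ψ γ' where
  frame_fst := h.frame_fst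
  frame_snd := h.frame_snd
  curve_fst s t ht := (h.curve_fst s t ht).congr_of_eventuallyEq (.of_forall (hγ · t ht))
  curve_snd s t ht := (h.curve_snd s t ht).congr_of_eventuallyEq
    ((hI.eventually_mem ht).mono (hγ s))

variable [CompleteSpace R]

theorem eq_Ad_add (hI : IsOpen I) (hIc : IsPreconnected I)
    (h : FrameEquations I w₁ w₂ e₁ e₂ ψ γ) (h' : FrameEquations I w₁ w₂ e₁ e₂ ψ' γ')
    {t₀ : ℝ} (ht₀ : t₀ ∈ I) (s₀ s : ℝ) {t : ℝ} (ht : t ∈ I) :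
    γ s t = Ad (ψ s₀ t₀ * (ψ' s₀ t₀)⁻¹) (γ' s t) +
      (γ s₀ t₀ - Ad (ψ s₀ t₀ * (ψ' s₀ t₀)⁻¹) (γ' s₀ t₀)) := by
  set g := ψ s₀ t₀ * (ψ' s₀ t₀)⁻¹
  have hψ (s : ℝ) {t : ℝ} (ht : t ∈ I) : ψ s t = g * ψ' s t := by
    rw [← mul_inv_eq_iff_eq_mul]
    refine Units.ext (eq_of_hasDerivAt_eq_zero (F := fun s t => (ψ s t * ↑(ψ' s t)⁻¹ : R)) hI hIc
      (fun s t ht => ?_) (fun s t ht => ?_) s s₀ ht ht₀)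
    · exact hasDerivAt_mul_inv_eq_zero (ψ := (ψ · t)) (h.frame_fst s t ht) (h'.frame_fst s t ht)
    · exact hasDerivAt_mul_inv_eq_zero (h.frame_snd s t ht) (h'.frame_snd s t ht)
  rw [← sub_eq_iff_eq_add']
  refine eq_of_hasDerivAt_eq_zero (F := fun s t => γ s t - Ad g (γ' s t)) hI hIc
    (fun s t ht => ?_) (fun s t ht => ?_) s s₀ ht ht₀
  · have := (h.curve_fst s t ht).sub ((Ad g).hasFDerivAt.comp_hasDerivAt s (h'.curve_fst s t ht))
    rwa [hψ s ht, Ad_mul_apply, sub_self] at this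
  · have := (h.curve_snd s t ht).sub ((Ad g).hasFDerivAt.comp_hasDerivAt t (h'.curve_snd s t ht))
    rwa [hψ s ht, Ad_mul_apply, sub_self] at this

end FrameEquations

end FrameEquations

section InverseMul

variable {R : Type*} [NormedRing R] [NormedAlgebra ℝ R] [CompleteSpace R] {g : ℝ → Rˣ} {x : ℝ}
  {B : R}

theorem hasDerivAt_inv_of_eq_mul (hg : HasDerivAt (fun y => (g y : R)) (B * g x) x) :
    HasDerivAt (fun y => (↑(g y)⁻¹ : R)) (↑(g x)⁻¹ * -B) x := by
  have h := hasDerivAt_units_inv hg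
  rwa [← mul_assoc, Units.mul_inv_cancel_right, ← mul_neg] at h

theorem hasDerivAt_inv_mul_of_eq_mul {C : R} {f : ℝ → R}
    (hg : HasDerivAt (fun y => (g y : R)) (B * g x) x)
    (hf : HasDerivAt f (C * g x + B * f x) x) :
    HasDerivAt (fun y => ↑(g y)⁻¹ * f y) (Ad (g x)⁻¹ C) x := by
  have h := (hasDerivAt_inv_of_eq_mul hg).mul hf
  rwa [mul_neg, neg_mul, mul_add, ← mul_assoc _ B, neg_add_cancel_comm_assoc, ← mul_assoc] at h

end InverseMul

variable {𝔸 : Type*} [NormedRing 𝔸] [NormedAlgebra ℝ 𝔸] {S : HermitianSymmetric 𝔸}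

namespace IsSpectralFunction

variable {n : ℕ} {I : Set ℝ} {Q : ℝ → ℝ → S.𝔪} {φ : ℝ → ℝ → ℝ → 𝔸ˣ}

theorem contDiffAt (h : S.IsSpectralFunction n I Q φ) (hI : IsOpen I) (s : ℝ) {t : ℝ}
    (ht : t ∈ I) (l : ℝ) :
    ContDiffAt ℝ ∞ (fun p : ℝ × ℝ × ℝ => (φ p.1 p.2.1 p.2.2 : 𝔸)) (s, t, l) :=
  h.smooth.contDiffAt ((isOpen_univ.prod (hI.prod isOpen_univ)).mem_nhds ⟨trivial, ht, trivial⟩)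

theorem hasDerivAt_s (h : S.IsSpectralFunction n I Q φ) (hI : IsOpen I) (s : ℝ) {t : ℝ}
    (ht : t ∈ I) (l : ℝ) : HasDerivAt (fun σ => (φ σ t l : 𝔸))
      (S.laxU l (S.jet (fun y => Q y t) s) * φ s t l) s := by
  rw [← h.deriv_s s t ht l]
  exact (((h.contDiffAt hI s ht l).differentiableAt (by simp)).comp
    (f := fun σ => (σ, t, l)) s (by fun_prop)).hasDerivAt

theorem hasDerivAt_t (h : S.IsSpectralFunction n I Q φ) (hI : IsOpen I) (s : ℝ) {t : ℝ}
    (ht : t ∈ I) (l : ℝ) : HasDerivAt (fun τ => (φ s τ l : 𝔸))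
      (S.laxV n l (S.jet (fun y => Q y t) s) * φ s t l) t := by
  rw [← h.deriv_t s t ht l]
  exact (((h.contDiffAt hI s ht l).differentiableAt (by simp)).comp
    (f := fun τ => (s, τ, l)) t (by fun_prop)).hasDerivAt

theorem hasDerivAt_spectral (h : S.IsSpectralFunction n I Q φ) (hI : IsOpen I) (s : ℝ) {t : ℝ}
    (ht : t ∈ I) (l : ℝ) : HasDerivAt (fun l => (φ s t l : 𝔸))
      (fderiv ℝ (fun p : ℝ × ℝ × ℝ => (φ p.1 p.2.1 p.2.2 : 𝔸)) (s, t, l) (0, 0, 1)) l :=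
  ((h.contDiffAt hI s ht l).differentiableAt (by simp)).hasFDerivAt.comp_hasDerivAt
    (f := fun l => (s, t, l)) l
    ((hasDerivAt_const l s).prodMk ((hasDerivAt_const l t).prodMk (hasDerivAt_id l)))

theorem hasDerivAt_deriv_spectral_s (h : S.IsSpectralFunction n I Q φ) (hI : IsOpen I) (s : ℝ)
    {t : ℝ} (ht : t ∈ I) : HasDerivAt (fun σ => deriv (fun l => (φ σ t l : 𝔸)) 0)
      (S.A * φ s t 0 + Q s t * deriv (fun l => (φ s t l : 𝔸)) 0) s := by
  have hφ : ContDiffAt ℝ 2 (fun p : ℝ × ℝ => (φ p.1 t p.2 : 𝔸)) (s, 0) :=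
    (contDiffAt_infty.1 (h.contDiffAt hI s ht 0) 2).comp
      (f := fun p : ℝ × ℝ => (p.1, t, p.2)) (s, 0) (by fun_prop)
  refine hasDerivAt_deriv_comm (F := fun σ l => (φ σ t l : 𝔸)) hφ ?_
  simp only [h.deriv_s s t ht]
  have hU := (hasDerivAt_laxU (S.jet (fun y => Q y t) s) 0).mul
    (h.hasDerivAt_spectral hI s ht 0).differentiableAt.hasDerivAt
  rwa [laxU_zero, jet_zero] at hU

theorem hasDerivAt_deriv_spectral_t (h : S.IsSpectralFunction n I Q φ) (hI : IsOpen I) (s : ℝ)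
    {t : ℝ} (ht : t ∈ I) : HasDerivAt (fun τ => deriv (fun l => (φ s τ l : 𝔸)) 0)
      (deriv (fun l => S.laxV n l (S.jet (fun y => Q y t) s)) 0 * φ s t 0 +
        S.laxV n 0 (S.jet (fun y => Q y t) s) * deriv (fun l => (φ s t l : 𝔸)) 0) t := by
  have hφ : ContDiffAt ℝ 2 (fun p : ℝ × ℝ => (φ s p.1 p.2 : 𝔸)) (t, 0) :=
    (contDiffAt_infty.1 (h.contDiffAt hI s ht 0) 2).comp
      (f := fun p : ℝ × ℝ => (s, p.1, p.2)) (t, 0) (by fun_prop)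
  refine hasDerivAt_deriv_comm (F := fun τ l => (φ s τ l : 𝔸)) hφ ?_
  simp only [h.deriv_t s t ht]
  exact (differentiable_laxV n (S.jet (fun y => Q y t) s) 0).hasDerivAt.mul
    (h.hasDerivAt_spectral hI s ht 0).differentiableAt.hasDerivAt

variable [FiniteDimensional ℝ 𝔸]

theorem frameEquations (h : S.IsSpectralFunction n I Q φ) (hI : IsOpen I) :
    FrameEquations I (fun s t => -(Q s t : 𝔸))
      (fun s t => -S.laxV n 0 (S.jet (fun y => Q y t) s)) (fun _ _ => S.A)
      (fun s t => deriv (fun l => S.laxV n l (S.jet (fun y => Q y t) s)) 0)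
      (fun s t => (φ s t 0)⁻¹) (symPohlmeyer φ) := by
  have : CompleteSpace 𝔸 := FiniteDimensional.complete ℝ 𝔸
  have hs (s : ℝ) {t : ℝ} (ht : t ∈ I) :
      HasDerivAt (fun σ => (φ σ t 0 : 𝔸)) (Q s t * φ s t 0) s := by
    simpa only [laxU_zero, jet_zero] using h.hasDerivAt_s hI s ht 0
  exact
    { frame_fst := fun s t ht => hasDerivAt_inv_of_eq_mul (g := (φ · t 0)) (hs s ht)
      frame_snd := fun s t ht => hasDerivAt_inv_of_eq_mul (h.hasDerivAt_t hI s ht 0)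
      curve_fst := fun s t ht => hasDerivAt_inv_mul_of_eq_mul (g := (φ · t 0)) (hs s ht)
        (h.hasDerivAt_deriv_spectral_s hI s ht)
      curve_snd := fun s t ht => hasDerivAt_inv_mul_of_eq_mul (h.hasDerivAt_t hI s ht 0)
        (h.hasDerivAt_deriv_spectral_t hI s ht) }

theorem symPohlmeyer_mem (h : S.IsSpectralFunction n I Q φ) (hI : IsOpen I) (s : ℝ) {t : ℝ}
    (ht : t ∈ I) : symPohlmeyer φ s t ∈ S.𝔤 := by
  have : CompleteSpace 𝔸 := FiniteDimensional.complete ℝ 𝔸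
  rw [S.mem_𝔤_iff]
  refine exists_mem_eq_exp_smul (g := fun l => (φ s t 0)⁻¹ * φ s t l) S.isCompact_G
    (fun l => S.G.mul_mem (S.G.inv_mem (h.mem_G s t ht 0)) (h.mem_G s t ht l))
    (inv_mul_cancel _) ?_
  exact (h.hasDerivAt_spectral hI s ht 0).differentiableAt.hasDerivAt.const_mul _

theorem contDiffOn_inv (h : S.IsSpectralFunction n I Q φ) :
    ContDiffOn ℝ ∞ (fun p : ℝ × ℝ => (↑(φ p.1 p.2 0)⁻¹ : 𝔸)) (Set.univ ×ˢ I) := by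
  have : CompleteSpace 𝔸 := FiniteDimensional.complete ℝ 𝔸
  exact contDiffOn_units_inv (g := fun p : ℝ × ℝ => φ p.1 p.2 0)
    (h.smooth.comp (f := fun p : ℝ × ℝ => (p.1, p.2, (0 : ℝ))) (by fun_prop)
      fun p hp => ⟨trivial, hp.2, trivial⟩)

theorem contDiffOn_symPohlmeyer (h : S.IsSpectralFunction n I Q φ) (hI : IsOpen I) :
    ContDiffOn ℝ ∞ (fun p : ℝ × ℝ => symPohlmeyer φ p.1 p.2) (Set.univ ×ˢ I) := by
  have hfderiv := h.smooth.fderiv_of_isOpen (m := ∞) (isOpen_univ.prod (hI.prod isOpen_univ))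
    (by simp)
  refine h.contDiffOn_inv.mul (ContDiffOn.congr ((hfderiv.comp
    (f := fun p : ℝ × ℝ => (p.1, p.2, (0 : ℝ))) (by fun_prop) fun p hp =>
      ⟨trivial, hp.2, trivial⟩).clm_apply (g := fun _ => ((0 : ℝ), (0 : ℝ), (1 : ℝ)))
      contDiffOn_const) fun p hp => ?_)
  exact (h.hasDerivAt_spectral hI p.1 hp.2 0).deriv

end IsSpectralFunction

theorem inv_mul_mul_eq_iff {g : 𝔸ˣ} {X Y : 𝔸} : ↑g⁻¹ * X * g = Y ↔ X = Ad g Y := by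
  rw [Ad_apply, mul_assoc, Units.inv_mul_eq_iff_eq_mul, Units.eq_mul_inv_iff_mul_eq]

theorem hasDerivAt_coe {f : ℝ → S.𝔤} {x : ℝ} (hf : DifferentiableAt ℝ f x) :
    HasDerivAt (fun y => (f y : 𝔸)) (deriv f x : S.𝔤) x :=
  S.𝔤.toSubmodule.subtypeL.hasFDerivAt.comp_hasDerivAt x hf.hasDerivAt

section ArcLength

variable [FiniteDimensional ℝ 𝔸]

/-- The adjoint action of `G` on its Lie algebra. -/
def Ad𝔤 {g : 𝔸ˣ} (hg : g ∈ S.G) : S.𝔤 ≃ₗ⁅ℝ⁆ S.𝔤 where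
  toFun X := ⟨Ad g X, Ad_mem_𝔤 hg X.2⟩
  invFun X := ⟨Ad g⁻¹ X, Ad_mem_𝔤 (S.G.inv_mem hg) X.2⟩
  map_add' X Y := Subtype.ext (map_add (Ad g) (X : 𝔸) Y)
  map_smul' c X := Subtype.ext (map_smul (Ad g) c (X : 𝔸))
  map_lie' := Subtype.ext (Ad_lie g _ _)
  left_inv X := Subtype.ext (by simp [Ad_apply, mul_assoc])
  right_inv X := Subtype.ext (by simp [Ad_apply, mul_assoc])

theorem killingForm_eq_neg_one {g : 𝔸ˣ} (hg : g ∈ S.G) {X : S.𝔤}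
    (hX : (X : 𝔸) = Ad g ((√S.χ)⁻¹ • S.A)) : killingForm ℝ S.𝔤 X X = -1 := by
  obtain rfl : X = Ad𝔤 hg ((√S.χ)⁻¹ • ⟨S.A, S.A_mem_𝔤⟩) := Subtype.ext hX
  have hA : killingForm ℝ S.𝔤 ⟨S.A, S.A_mem_𝔤⟩ ⟨S.A, S.A_mem_𝔤⟩ = -S.χ := (neg_neg _).symm
  rw [LieAlgebra.killingForm_of_equiv_apply, map_smul, map_smul, LinearMap.smul_apply, hA,
    smul_smul, ← mul_inv, Real.mul_self_sqrt χ_pos.le, smul_eq_mul, mul_neg,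
    inv_mul_cancel₀ χ_pos.ne']

end ArcLength

section CurveFlows

/-- The equations of `IsCurveFlow` for the frame `ψ` and the curve `γ`, as frame equations. -/
def CurveFlowEquations (S : HermitianSymmetric 𝔸) (n : ℕ) (I : Set ℝ) (q : ℝ → ℝ → S.𝔪)
    (ψ : ℝ → ℝ → 𝔸ˣ) (γ : ℝ → ℝ → 𝔸) : Prop :=
  FrameEquations I (fun x t => (q x t : 𝔸))
    (fun x t => S.wPerp n (S.jet (fun y => q y t) x) + S.wPar n (S.jet (fun y => q y t) x))
    (fun _ _ => (√S.χ)⁻¹ • S.A)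
    (fun x t => S.hPerp n (S.jet (fun y => q y t) x) + S.hPar n (S.jet (fun y => q y t) x)) ψ γ

/-- The frame equations satisfied by `φ⁻¹` at `λ = 0` and the Sym–Pohlmeyer curve of a solution `φ`
of the linear system `φ_s = U φ`, `φ_t = V φ`. -/
def LaxFrameEquations (S : HermitianSymmetric 𝔸) (n : ℕ) (I : Set ℝ) (Q : ℝ → ℝ → S.𝔪)
    (ψ : ℝ → ℝ → 𝔸ˣ) (γ : ℝ → ℝ → 𝔸) : Prop :=
  FrameEquations I (fun s t => -(Q s t : 𝔸))
    (fun s t => -S.laxV n 0 (S.jet (fun y => Q y t) s)) (fun _ _ => S.A)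
    (fun s t => deriv (fun l => S.laxV n l (S.jet (fun y => Q y t) s)) 0) ψ γ

variable {n : ℕ} {I : Set ℝ} {q Q : ℝ → ℝ → S.𝔪} {φ : ℝ → ℝ → ℝ → 𝔸ˣ} {ψ : ℝ → ℝ → 𝔸ˣ}
  {γ : ℝ → ℝ → S.𝔤}

theorem IsCurveFlow.curveFlowEquations (h : S.IsCurveFlow n I q ψ γ) (hI : IsOpen I) :
    S.CurveFlowEquations n I q ψ fun x t => γ x t := by
  have hψ : ContDiffOn ℝ 1 (fun p : ℝ × ℝ => (ψ p.1 p.2 : 𝔸)) (Set.univ ×ˢ I) :=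
    h.smooth_frame.of_le (mod_cast le_top)
  have hγ : ContDiffOn ℝ 1 (fun p : ℝ × ℝ => (γ p.1 p.2 : 𝔸)) (Set.univ ×ˢ I) :=
    S.𝔤.toSubmodule.subtypeL.contDiff.comp_contDiffOn (h.smooth_curve.of_le (mod_cast le_top))
  refine ⟨fun x t ht => ?_, fun x t ht => ?_, fun x t ht => ?_, fun x t ht => ?_⟩
  · rw [← (Units.inv_mul_eq_iff_eq_mul _).1 (h.ω_x x t ht)]
    exact (differentiableAt_fst_slice hI (F := fun x t => (ψ x t : 𝔸)) hψ x ht).hasDerivAt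
  · rw [← (Units.inv_mul_eq_iff_eq_mul _).1 (h.ω_t x t ht)]
    exact (differentiableAt_snd_slice hI (F := fun x t => (ψ x t : 𝔸)) hψ x ht).hasDerivAt
  · rw [← inv_mul_mul_eq_iff.1 (h.e_x x t ht)]
    exact (differentiableAt_fst_slice hI (F := fun x t => (γ x t : 𝔸)) hγ x ht).hasDerivAt
  · rw [← inv_mul_mul_eq_iff.1 (h.e_t x t ht)]
    exact (differentiableAt_snd_slice hI (F := fun x t => (γ x t : 𝔸)) hγ x ht).hasDerivAt

variable [FiniteDimensional ℝ 𝔸]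

theorem CurveFlowEquations.isCurveFlow (hI : IsOpen I) (hq : S.MergedFlow n I q)
    (hψ : ∀ x, ∀ t ∈ I, ψ x t ∈ S.G)
    (hψ_smooth : ContDiffOn ℝ ∞ (fun p : ℝ × ℝ => (ψ p.1 p.2 : 𝔸)) (Set.univ ×ˢ I))
    (hγ_smooth : ContDiffOn ℝ ∞ (fun p : ℝ × ℝ => γ p.1 p.2) (Set.univ ×ˢ I))
    (h : S.CurveFlowEquations n I q ψ fun x t => γ x t) : S.IsCurveFlow n I q ψ γ where
  flow := hq
  mem_G := hψ
  smooth_frame := hψ_smooth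
  smooth_curve := hγ_smooth
  arclength x t ht := by
    have hγ := hasDerivAt_coe
      (differentiableAt_fst_slice hI (hγ_smooth.of_le (mod_cast le_top)) x ht)
    rw [killingForm_eq_neg_one (hψ x t ht) (hγ.unique (h.curve_fst x t ht)), neg_neg]
  e_x x t ht := inv_mul_mul_eq_iff.2 (h.curve_fst x t ht).deriv
  ω_x x t ht := (Units.inv_mul_eq_iff_eq_mul _).2 (h.frame_fst x t ht).deriv
  e_t x t ht := inv_mul_mul_eq_iff.2 (h.curve_snd x t ht).deriv
  ω_t x t ht := (Units.inv_mul_eq_iff_eq_mul _).2 (h.frame_snd x t ht).deriv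

theorem Corresponds.frameEquations_iff {γ : ℝ → ℝ → 𝔸} (h : S.Corresponds (n + 2) q Q)
    (hQ : S.SmoothOn (S.isoTimes (n + 2) I) Q) :
    S.LaxFrameEquations (n + 2) (S.isoTimes (n + 2) I) Q
        (fun s t => ψ (√S.χ * s) (S.κ (n + 2) * t)) (fun s t => γ (√S.χ * s) (S.κ (n + 2) * t)) ↔
      S.CurveFlowEquations (n + 2) I q ψ γ := by
  have hχ := (sqrt_χ_pos (S := S)).ne'
  refine FrameEquations.rescale_iff hχ (κ_pos _).ne' (fun s t _ => ?_)
    (fun s t ht => h.neg_laxV_zero_eq hQ ht s) (fun _ _ _ => (smul_inv_smul₀ hχ _).symm)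
    (fun s t ht => h.deriv_laxV_eq hQ ht s)
  rw [h, ← smul_neg, Submodule.coe_smul, smul_inv_smul₀ hχ, Submodule.coe_neg]

theorem IsSpectralFunction.exists_isCurveFlow (h : S.Corresponds (n + 2) q Q) (hI : IsOpen I)
    (hQ : S.IsospectralFlow (n + 2) (S.isoTimes (n + 2) I) Q)
    (hφ : S.IsSpectralFunction (n + 2) (S.isoTimes (n + 2) I) Q φ) :
    ∃ (ψ : ℝ → ℝ → 𝔸ˣ) (γ : ℝ → ℝ → S.𝔤),
      (∀ s, ∀ t ∈ S.isoTimes (n + 2) I, ψ (√S.χ * s) (S.κ (n + 2) * t) = (φ s t 0)⁻¹) ∧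
      (∀ s, ∀ t ∈ S.isoTimes (n + 2) I,
        (γ (√S.χ * s) (S.κ (n + 2) * t) : 𝔸) = symPohlmeyer φ s t) ∧
      S.IsCurveFlow (n + 2) I q ψ γ := by
  have hI' := isOpen_isoTimes (S := S) (n + 2) hI
  have hχ := (sqrt_χ_pos (S := S)).ne'
  have hκ := (κ_pos (S := S) (n + 2)).ne'
  obtain ⟨p, hp⟩ := (S.𝔤.incl : S.𝔤 →ₗ[ℝ] 𝔸).exists_leftInverse_of_injective
    (LinearMap.ker_eq_bot.2 Subtype.val_injective)
  have hcoe {X : 𝔸} (hX : X ∈ S.𝔤) : (p X : 𝔸) = X :=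
    congrArg Subtype.val (LinearMap.congr_fun hp ⟨X, hX⟩)
  set γ : ℝ → ℝ → 𝔸 := fun x τ => symPohlmeyer φ ((√S.χ)⁻¹ * x) ((S.κ (n + 2))⁻¹ * τ)
  set ψ : ℝ → ℝ → 𝔸ˣ := fun x τ => (φ ((√S.χ)⁻¹ * x) ((S.κ (n + 2))⁻¹ * τ) 0)⁻¹
  have hγ (s t : ℝ) : γ (√S.χ * s) (S.κ (n + 2) * t) = symPohlmeyer φ s t := by
    simp only [γ, inv_mul_cancel_left₀ hχ, inv_mul_cancel_left₀ hκ]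
  have hψ (s t : ℝ) : ψ (√S.χ * s) (S.κ (n + 2) * t) = (φ s t 0)⁻¹ := by
    simp only [ψ, inv_mul_cancel_left₀ hχ, inv_mul_cancel_left₀ hκ]
  have hmaps : Set.MapsTo (fun y : ℝ × ℝ => ((√S.χ)⁻¹ * y.1, (S.κ (n + 2))⁻¹ * y.2))
      (Set.univ ×ˢ I) (Set.univ ×ˢ S.isoTimes (n + 2) I) :=
    fun y hy => ⟨trivial, inv_κ_mul_mem_isoTimes hy.2⟩
  have hframe : S.CurveFlowEquations (n + 2) I q ψ γ := by
    rw [← h.frameEquations_iff hQ.1]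
    simp only [hψ, hγ]
    exact hφ.frameEquations hI'
  refine ⟨ψ, fun x τ => p (γ x τ), fun s t _ => hψ s t, fun s t ht => ?_, ?_⟩
  · change (p (γ _ _) : 𝔸) = _
    rw [hγ, hcoe (hφ.symPohlmeyer_mem hI' s ht)]
  · exact CurveFlowEquations.isCurveFlow hI (h.mergedFlow_iff.2 hQ)
      (fun x τ hτ => S.G.inv_mem (hφ.mem_G _ _ (inv_κ_mul_mem_isoTimes hτ) 0))
      (hφ.contDiffOn_inv.comp (by fun_prop) hmaps)
      ((LinearMap.toContinuousLinearMap p).contDiff.comp_contDiffOn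
        ((hφ.contDiffOn_symPohlmeyer hI').comp (by fun_prop) hmaps))
      (hframe.congr_curve hI fun x τ hτ =>
        hcoe (hφ.symPohlmeyer_mem hI' _ (inv_κ_mul_mem_isoTimes hτ)))

theorem IsCurveFlow.exists_eq_Ad_symPohlmeyer_add (h : S.Corresponds (n + 2) q Q)
    (hI : IsOpen I) (hI' : I.OrdConnected)
    (hQ : S.SmoothOn (S.isoTimes (n + 2) I) Q)
    (hφ : S.IsSpectralFunction (n + 2) (S.isoTimes (n + 2) I) Q φ)
    (hγ : S.IsCurveFlow (n + 2) I q ψ γ) :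
    ∃ g ∈ S.G, ∃ a ∈ S.𝔤, ∀ s, ∀ t ∈ S.isoTimes (n + 2) I,
      (γ (√S.χ * s) (S.κ (n + 2) * t) : 𝔸) = g * symPohlmeyer φ s t * ↑g⁻¹ + a := by
  have : CompleteSpace 𝔸 := FiniteDimensional.complete ℝ 𝔸
  obtain hempty | ⟨t₀, ht₀⟩ := (S.isoTimes (n + 2) I).eq_empty_or_nonempty
  · exact ⟨1, S.G.one_mem, 0, S.𝔤.zero_mem, fun s t ht => by simp [hempty] at ht⟩
  have hconn : IsPreconnected (S.isoTimes (n + 2) I) :=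
    (hI'.preimage_mono (f := fun t => S.κ (n + 2) * t)
      fun _ _ h => mul_le_mul_of_nonneg_left h (κ_pos _).le).isPreconnected
  have hG : ψ (√S.χ * 0) (S.κ (n + 2) * t₀) * (φ 0 t₀ 0)⁻¹⁻¹ ∈ S.G :=
    S.G.mul_mem (hγ.mem_G _ _ ht₀) (S.G.inv_mem (S.G.inv_mem (hφ.mem_G 0 t₀ ht₀ 0)))
  have hI'' := isOpen_isoTimes (S := S) (n + 2) hI
  exact ⟨_, hG, _, sub_mem (γ _ _).2 (Ad_mem_𝔤 hG (hφ.symPohlmeyer_mem hI'' 0 ht₀)),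
    fun s t ht => ((h.frameEquations_iff hQ).2 (hγ.curveFlowEquations hI)).eq_Ad_add hI'' hconn
      (hφ.frameEquations hI'') ht₀ 0 s ht⟩

end CurveFlows

end HermitianSymmetric

end

theorem mainTheorem8 {𝔸 : Type*} [NormedRing 𝔸] [NormedAlgebra ℝ 𝔸] [FiniteDimensional ℝ 𝔸]
    (S : HermitianSymmetric 𝔸) :
    -- the members of the hierarchy are well-defined `𝔪`-valued differential functions
    (∀ n, S.IsDifferential (S.hier n) ∧ (∀ u, S.hier n u ∈ S.𝔪) ∧
      ∃! p, S.IsPrimitive p (S.adVar (S.Jinv (S.hier n)))) ∧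
    -- the isospectral flows are given by the Lax pair
    (∀ (n : ℕ) (I : Set ℝ) (Q : ℝ → ℝ → S.𝔪), IsOpen I → I.OrdConnected →
      (S.IsospectralFlow n I Q ↔ S.SmoothOn I Q ∧ S.ZeroCurvature n I Q)) ∧
    -- the two hierarchies coincide under the transformation
    (∀ (n : ℕ) (I : Set ℝ) (q Q : ℝ → ℝ → S.𝔪), IsOpen I → I.OrdConnected →
      S.Corresponds n q Q → (S.MergedFlow n I q ↔ S.IsospectralFlow n (S.isoTimes n I) Q)) ∧
    -- the `+2` and `+3` flows are the NLS and mKdV systems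
    (∀ (I : Set ℝ) (q : ℝ → ℝ → S.𝔪), IsOpen I → I.OrdConnected →
      (S.MergedFlow 2 I q ↔ S.NLS S.χ I q) ∧ (S.IsospectralFlow 2 I q ↔ S.NLS 1 I q) ∧
      (S.MergedFlow 3 I q ↔ S.MKdV S.χ I q) ∧ (S.IsospectralFlow 3 I q ↔ S.MKdV 1 I q)) ∧
    -- which are invariant under `Ad(H)`
    (∀ (c : ℝ) (I : Set ℝ) (Q : ℝ → ℝ → S.𝔪), IsOpen I → I.OrdConnected → ∀ g ∈ S.H,
      ∃ Q' : ℝ → ℝ → S.𝔪,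
        (∀ s t, (Q' s t : 𝔸) = (g : 𝔸) * (Q s t : 𝔸) * ((g⁻¹ : 𝔸ˣ) : 𝔸)) ∧
        (S.NLS c I Q → S.NLS c I Q') ∧ (S.MKdV c I Q → S.MKdV c I Q')) ∧
    -- the curve flows coincide for `n ≥ 2`
    (∀ (n : ℕ) (I : Set ℝ) (q Q : ℝ → ℝ → S.𝔪), 2 ≤ n → IsOpen I → I.OrdConnected →
      S.Corresponds n q Q → S.IsospectralFlow n (S.isoTimes n I) Q →
      -- the motion and the connection of the frame correspond to the Lax coefficients
      (∀ s, ∀ t ∈ S.isoTimes n I,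
        S.laxVm n 1 (S.jet (fun y => Q y t) s) =
          S.κ n • S.hPerp n (S.jet (fun y => q y (S.κ n * t)) (√S.χ * s)) ∧
        S.laxVh n 1 (S.jet (fun y => Q y t) s) =
          S.κ n • S.hPar n (S.jet (fun y => q y (S.κ n * t)) (√S.χ * s)) ∧
        S.laxVm n 0 (S.jet (fun y => Q y t) s) =
          -(S.κ n • S.wPerp n (S.jet (fun y => q y (S.κ n * t)) (√S.χ * s))) ∧
        S.laxVh n 0 (S.jet (fun y => Q y t) s) =
          -(S.κ n • S.wPar n (S.jet (fun y => q y (S.κ n * t)) (√S.χ * s)))) ∧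
      ∀ φ : ℝ → ℝ → ℝ → 𝔸ˣ, S.IsSpectralFunction n (S.isoTimes n I) Q φ →
        -- every Sym–Pohlmeyer curve is a non-stretching curve flow determined by the `+n` flow
        (∃ (ψ : ℝ → ℝ → 𝔸ˣ) (γ : ℝ → ℝ → S.𝔤),
          (∀ s, ∀ t ∈ S.isoTimes n I, ψ (√S.χ * s) (S.κ n * t) = (φ s t 0)⁻¹) ∧
          (∀ s, ∀ t ∈ S.isoTimes n I,
            (γ (√S.χ * s) (S.κ n * t) : 𝔸) = HermitianSymmetric.symPohlmeyer φ s t) ∧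
          S.IsCurveFlow n I q ψ γ) ∧
        -- every such curve flow is the Sym–Pohlmeyer curve up to a rigid motion
        (∀ (ψ : ℝ → ℝ → 𝔸ˣ) (γ : ℝ → ℝ → S.𝔤), S.IsCurveFlow n I q ψ γ →
          ∃ g ∈ S.G, ∃ a ∈ S.𝔤, ∀ s, ∀ t ∈ S.isoTimes n I,
            (γ (√S.χ * s) (S.κ n * t) : 𝔸) =
              (g : 𝔸) * HermitianSymmetric.symPohlmeyer φ s t * ((g⁻¹ : 𝔸ˣ) : 𝔸) + a)) := by
  open HermitianSymmetric in
  refine ⟨fun n => ⟨isDiffFun_hier n, hier_mem n, existsUnique_isPrimitive_adVar_jinv_hier n⟩,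
    fun n I Q hI _ => isospectralFlow_iff_smoothOn_and_zeroCurvature hI,
    fun n I q Q _ _ h => h.mergedFlow_iff,
    fun I q _ _ => ⟨nls_iff.symm, isospectralFlow_two_iff_nls, mkdv_iff.symm,
      isospectralFlow_three_iff_mkdv⟩,
    fun c I Q hI _ g hg => ⟨fun s t => Ad𝔪 hg (Q s t), fun _ _ => rfl, .Ad𝔪 hg hI, .Ad𝔪 hg hI⟩,
    fun n I q Q hn hI hI' h hQ => ?_⟩
  obtain ⟨n, rfl⟩ := Nat.exists_eq_add_of_le' hn
  exact ⟨fun s t ht => ⟨h.laxVm_one hQ.1 ht s, h.laxVh_one hQ.1 ht s, h.laxVm_zero hQ.1 ht s,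
      h.laxVh_zero hQ.1 ht s⟩,
    fun φ hφ => ⟨hφ.exists_isCurveFlow h hI hQ, fun ψ γ hγ =>
      hγ.exists_eq_Ad_symPohlmeyer_add h hI hI' hQ.1 hφ⟩⟩
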